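/- **Definitions.** The rudimentary functions are the functions from $n$-tuples of sets to sets ($n\ge 1$) generated from $F(x_1,\dots,x_n)=x_i$, $F(x_1,\dots,x_n)=\{x_i,x_j\}$ and $F(x_1,\dots,x_n)=x_i\setminus x_j$ by composition and by the scheme $F(x_1,\dots,x_n)=\bigcup_{y\in x_1}H(y,x_2,\dots,x_n)$. The rudimentary closure of a set $x$ is the smallest set $y$ with $x\subseteq y$ and $x\in y$ that is closed under all rudimentary functions. Let $J_1$ be the rudimentary closure of $\emptyset$ and $J_2$ the rudimentary closure of $J_1$. An *$\iota$-set* is an element of $J_2$, and an *$\iota$-subset* of $X$ is an $\iota$-set included in $X$. An *$\iota$-class* is a subset of $J_2$ that is first-order definable over $(J_2,\in)$ with parameters from $J_2$ and whose intersection with every $\iota$-set is an $\iota$-set. An *$\iota$-relation* on an $\iota$-class $X$ is an $\iota$-class included in $X\times X$ (with Kuratowski pairs). An *$\iota$-function* from an $\iota$-class $X$ to an $\iota$-class $Y$ is a function $F:X\to Y$ whose graph is an $\iota$-class and such that for each $\iota$-subset $x$ of $X$ the image $F[x]$ is included in an $\iota$-set. Natural numbers are von Neumann numbers, integers are blocks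 of pairs of natural numbers, and rational numbers are blocks of pairs of integers with nonzero second component, as usual; $\mathbf Q$ is the resulting set. Let $\mathbf R_\iota$ be the set of all Dedekind $\iota$-cuts, i.e. of all $\iota$-subsets of $\mathbf Q$ that are neither $\emptyset$ nor $\mathbf Q$, have no greatest element, and contain every rational less than any element they contain. Addition $+$, multiplication $\cdot$ and the order $\le$ (inclusion) on cuts are the standard ones. **Theorem 3.2.** $\mathbf R_\iota$ is an $\iota$-class, $+$ and $\cdot$ are $\iota$-functions from $\mathbf R_\iota^2$ to $\mathbf R_\iota$, and $\le$ is an $\iota$-relation on $\mathbf R_\iota$. With these operations $\mathbf R_\iota$ is a field, and the subfield of $\mathbf R_\iota$ generated by any $\iota$-subset of $\mathbf R_\iota$ is an $\iota$-set. Every nonempty $\iota$-subset of $\mathbf R_\iota$ that is bounded above in $\mathbf R_\iota$ has a least upper bound in $\mathbf R_\iota$, and the map that takes each nonempty $\iota$-subset of $\mathbf R_\iota$ that is bounded above to its least upper bound is an $\iota$-function (from the $\iota$-class of all such $\iota$-subsets to $\mathbf R_\iota$). -/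

import Mathlib

noncomputable section

namespace IotaAnalysis

/-! ## Rudimentary functions and the set `J₂` -/

/-- Construction terms for rudimentary functions of `n` set variables: projections, unordered
pairs, differences, composition, and the union scheme `⋃_{y ∈ x₁} H(y, x₂, …, xₙ)`.
There are no terms with `n = 0`. -/
inductive RudTerm : ℕ → Type
  | proj {n : ℕ} (i : Fin n) : RudTerm n
  | upair {n : ℕ} (i j : Fin n) : RudTerm n
  | diff {n : ℕ} (i j : Fin n) : RudTerm n
  | comp {n k : ℕ} (G : RudTerm k) (H : Fin k → RudTerm n) : RudTerm n
  | union {n : ℕ} (H : RudTerm (n + 1)) : RudTerm (n + 1)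

/-- The function on sets described by a construction term. -/
def RudTerm.eval : {n : ℕ} → RudTerm n → (Fin n → ZFSet.{0}) → ZFSet.{0}
  | _, .proj i, x => x i
  | _, .upair i j, x => {x i, x j}
  | _, .diff i j, x => x i \ x j
  | _, .comp G H, x => G.eval (fun i => (H i).eval x)
  | _, .union H, x =>
      ZFSet.iUnion (fun y : (x 0 : ZFSet.{0}) => H.eval (Fin.cons (y : ZFSet.{0}) (Fin.tail x)))

/-- A function from `n`-tuples of sets to sets is rudimentary if it is generated by the
clauses above. -/
def IsRudimentary {n : ℕ} (F : (Fin n → ZFSet.{0}) → ZFSet.{0}) : Prop :=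
  ∃ t : RudTerm n, t.eval = F

/-- The set `y` is closed under application of all rudimentary functions. -/
def IsRudClosed (y : ZFSet.{0}) : Prop :=
  ∀ (n : ℕ) (F : (Fin n → ZFSet.{0}) → ZFSet.{0}), IsRudimentary F →
    ∀ v : Fin n → ZFSet.{0}, (∀ i, v i ∈ y) → F v ∈ y

/-- The rudimentary closure of the set `x`: the set of all values of rudimentary functions on
tuples from `x ∪ {x}`. By `rudClosure_isLeast` it is the smallest set which includes `x`, has
`x` as an element, and is closed under all rudimentary functions. -/
def rudClosure (x : ZFSet.{0}) : ZFSet.{0} :=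
  ZFSet.range (fun p : Σ n : ℕ, RudTerm n × (Fin n → (insert x x : ZFSet.{0})) =>
    p.2.1.eval (fun i => (p.2.2 i : ZFSet.{0})))

theorem mem_rudClosure {x z : ZFSet.{0}} :
    z ∈ rudClosure x ↔ ∃ (n : ℕ) (t : RudTerm n) (v : Fin n → ZFSet.{0}),
      (∀ i, v i ∈ insert x x) ∧ t.eval v = z := by
  unfold rudClosure
  rw [ZFSet.mem_range]
  constructor
  · rintro ⟨⟨n, t, v⟩, h⟩
    exact ⟨n, t, fun i => v i, fun i => (v i).2, h⟩
  · rintro ⟨n, t, v, hv, h⟩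
    exact ⟨⟨n, t, fun i => ⟨v i, hv i⟩⟩, h⟩

theorem isRudClosed_rudClosure (x : ZFSet.{0}) : IsRudClosed (rudClosure x) := by
  rintro n F ⟨t, rfl⟩ v hv
  choose m s w hw hs using fun i => mem_rudClosure.1 (hv i)
  let e := finSigmaFinEquiv (n := m)
  refine mem_rudClosure.2 ⟨_, RudTerm.comp t (fun i => RudTerm.comp (s i)
    (fun j => RudTerm.proj (e ⟨i, j⟩))), fun k => w (e.symm k).1 (e.symm k).2,
    fun k => hw _ _, ?_⟩
  let u : (Σ i, Fin (m i)) → ZFSet.{0} := fun p => w p.1 p.2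
  change t.eval (fun i => (s i).eval fun j => u (e.symm (e ⟨i, j⟩))) = t.eval v
  simp only [Equiv.symm_apply_apply]
  congr 1
  funext i
  exact hs i

/-- `rudClosure x` is the smallest rudimentarily closed set including `x` and containing `x`. -/
theorem rudClosure_isLeast (x : ZFSet.{0}) :
    IsLeast {y : ZFSet.{0} | x ⊆ y ∧ x ∈ y ∧ IsRudClosed y} (rudClosure x) := by
  have key : ∀ z ∈ insert x x, z ∈ rudClosure x := fun z hz =>
    mem_rudClosure.2 ⟨1, RudTerm.proj 0, fun _ => z, fun _ => hz, rfl⟩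
  refine ⟨⟨fun z hz => key z (ZFSet.mem_insert_of_mem x hz), key x (ZFSet.mem_insert x x),
    isRudClosed_rudClosure x⟩, ?_⟩
  rintro y ⟨hsub, hmem, hcl⟩ z hz
  obtain ⟨n, t, v, hv, rfl⟩ := mem_rudClosure.1 hz
  refine hcl n _ ⟨t, rfl⟩ v (fun i => ?_)
  rcases ZFSet.mem_insert_iff.1 (hv i) with h | h
  · rw [h]; exact hmem
  · exact hsub h

/-- `J₁` is the rudimentary closure of `J₀ = ∅`. -/
def J1 : ZFSet.{0} := rudClosure ∅

/-- `J₂` is the rudimentary closure of `J₁`. -/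
def J2 : ZFSet.{0} := rudClosure J1

/-! ## Definable subsets -/

/-- The non-logical symbols of the language of set theory: `∈` and `⊆` (equality is logical). -/
inductive SetRel : ℕ → Type
  | mem : SetRel 2
  | sub : SetRel 2

/-- The first-order language with the two binary relation symbols `∈` and `⊆`. -/
def setLanguage : FirstOrder.Language := ⟨fun _ => Empty, SetRel⟩

/-- The interpretation of the language of set theory in the universe of discourse `x`. -/
instance setStructure (x : ZFSet.{0}) : setLanguage.Structure x where
  funMap := fun f _ => f.elim
  RelMap := fun r =>
    match r with
    | .mem => fun v => (v 0 : ZFSet.{0}) ∈ (v 1 : ZFSet.{0})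
    | .sub => fun v => (v 0 : ZFSet.{0}) ⊆ (v 1 : ZFSet.{0})

/-- `Y` is a definable subset of `x`: it is defined by a formula of set theory relativized to `x`,
with parameters from `x`. -/
def IsDefinableSubset (x : ZFSet.{0}) (Y : Set ZFSet.{0}) : Prop :=
  (∀ a ∈ Y, a ∈ x) ∧ (Set.univ : Set x).Definable₁ setLanguage {a : x | (a : ZFSet.{0}) ∈ Y}

/-! ## ι-sets, ι-classes, ι-relations and ι-functions -/

/-- An ι-set is an element of `J₂`. -/
def IsIotaSet (x : ZFSet.{0}) : Prop := x ∈ J2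

/-- An ι-class is a definable subset of `J₂` whose intersection with every ι-set is an ι-set. -/
def IsIotaClass (X : Set ZFSet.{0}) : Prop :=
  IsDefinableSubset J2 X ∧
    ∀ z : ZFSet.{0}, IsIotaSet z → IsIotaSet (z.sep (fun a => a ∈ X))

/-- The ι-subsets of `X`: the ι-sets all of whose elements belong to `X`. -/
def IsIotaSubset (x : ZFSet.{0}) (X : Set ZFSet.{0}) : Prop :=
  IsIotaSet x ∧ (x : Set ZFSet.{0}) ⊆ X

/-- The cartesian product of two classes, with Kuratowski pairs. -/
def classProd (X Y : Set ZFSet.{0}) : Set ZFSet.{0} :=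
  {z | ∃ a ∈ X, ∃ b ∈ Y, z = ZFSet.pair a b}

/-- The graph of a function `F` with domain `X`. -/
def graph (X : Set ZFSet.{0}) (F : ZFSet.{0} → ZFSet.{0}) : Set ZFSet.{0} :=
  {z | ∃ a ∈ X, z = ZFSet.pair a (F a)}

/-- `R` is an ι-relation on the ι-class `X`. -/
def IsIotaRelation (X R : Set ZFSet.{0}) : Prop :=
  IsIotaClass X ∧ IsIotaClass R ∧ R ⊆ classProd X X

/-- `F` (restricted to `X`) is an ι-function from the ι-class `X` to the ι-class `Y`: it maps `X`
to `Y`, its graph is an ι-class, and the image of each ι-subset of `X` is contained in an ι-set.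
The values of `F` outside `X` play no role. -/
structure IsIotaFunction (X Y : Set ZFSet.{0}) (F : ZFSet.{0} → ZFSet.{0}) : Prop where
  domain : IsIotaClass X
  codomain : IsIotaClass Y
  mapsTo : Set.MapsTo F X Y
  graph_class : IsIotaClass (graph X F)
  image_bound : ∀ x : ZFSet.{0}, IsIotaSubset x X → ∃ y : ZFSet.{0}, IsIotaSet y ∧ ∀ a ∈ x, F a ∈ y

open Classical in
/-- The first component of an ordered pair (and `∅` for sets which are not ordered pairs). -/
def fst (p : ZFSet.{0}) : ZFSet.{0} :=
  if h : ∃ a b : ZFSet.{0}, p = ZFSet.pair a b then h.choose else ∅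

open Classical in
/-- The second component of an ordered pair (and `∅` for sets which are not ordered pairs). -/
def snd (p : ZFSet.{0}) : ZFSet.{0} :=
  if h : ∃ b a : ZFSet.{0}, p = ZFSet.pair a b then h.choose else ∅

/-! ## Numbers as sets -/

/-- The natural number `n` as the set `{0, …, n - 1}`. -/
def natCode : ℕ → ZFSet.{0}
  | 0 => ∅
  | n + 1 => insert (natCode n) (natCode n)

/-- The integer `z` as a block of the usual equivalence relation on pairs of natural numbers:
the set of all `⟨m, n⟩` with `m - n = z`. -/
def intCode (z : ℤ) : ZFSet.{0} :=
  ZFSet.range (fun p : {p : ℕ × ℕ // (p.1 : ℤ) - (p.2 : ℤ) = z} =>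
    ZFSet.pair (natCode p.1.1) (natCode p.1.2))

/-- The rational number `q` as a block of the usual equivalence relation on pairs of integers with
nonzero second component: the set of all `⟨a, b⟩` with `b ≠ 0` and `a / b = q`. -/
def ratCode (q : ℚ) : ZFSet.{0} :=
  ZFSet.range (fun p : {p : ℤ × ℤ // p.2 ≠ 0 ∧ (p.1 : ℚ) / (p.2 : ℚ) = q} =>
    ZFSet.pair (intCode p.1.1) (intCode p.1.2))

/-- The set of all rational numbers. -/
def ratSet : ZFSet.{0} := ZFSet.range ratCode

/-- The rational numbers (in the sense of Mathlib) that belong to the set `x`. -/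
def toRats (x : ZFSet.{0}) : Set ℚ := {q | ratCode q ∈ x}

/-- A set of rational numbers (in the sense of Mathlib) as a subset of `ratSet`. -/
def ofRats (A : Set ℚ) : ZFSet.{0} := ZFSet.range (fun q : A => ratCode q)

/-! ## Dedekind cuts and their standard operations -/

/-- Lower Dedekind cuts of `ℚ`. -/
def IsCut (A : Set ℚ) : Prop :=
  A ≠ ∅ ∧ A ≠ Set.univ ∧ (¬ ∃ a, IsGreatest A a) ∧ ∀ a ∈ A, ∀ b < a, b ∈ A

/-- The sum of two cuts. -/
def cutAdd (A B : Set ℚ) : Set ℚ := {q | ∃ a ∈ A, ∃ b ∈ B, q = a + b}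

/-- The additive inverse of a cut. -/
def cutNeg (A : Set ℚ) : Set ℚ := {q | ∃ r, r ∉ A ∧ q < -r}

/-- The cut of the number zero. -/
def cutZero : Set ℚ := {q | q < 0}

/-- The product of two nonnegative cuts. -/
def cutMulNonneg (A B : Set ℚ) : Set ℚ :=
  cutZero ∪ {q | ∃ a ∈ A, ∃ b ∈ B, 0 ≤ a ∧ 0 ≤ b ∧ q = a * b}

open Classical in
/-- The product of two cuts, by the usual sign rules. -/
def cutMul (A B : Set ℚ) : Set ℚ :=
  if cutZero ⊆ A then
    if cutZero ⊆ B then cutMulNonneg A B else cutNeg (cutMulNonneg A (cutNeg B))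
  else
    if cutZero ⊆ B then cutNeg (cutMulNonneg (cutNeg A) B)
    else cutMulNonneg (cutNeg A) (cutNeg B)

/-! ## The ι-real line -/

/-- The ι-real line: the set of all Dedekind ι-cuts, i.e. of the ι-subsets of the set of rational
numbers which are lower Dedekind cuts. As a subtype of `ZFSet` it carries the order `≤` given by
inclusion, which is the standard order of cuts. -/
def RIota : Set ZFSet.{0} :=
  {x | IsIotaSubset x (ratSet : Set ZFSet.{0}) ∧ IsCut (toRats x)}

/-- Addition of cuts, as an operation on sets. -/
def add (x y : ZFSet.{0}) : ZFSet.{0} := ofRats (cutAdd (toRats x) (toRats y))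

/-- Multiplication of cuts, as an operation on sets. -/
def mul (x y : ZFSet.{0}) : ZFSet.{0} := ofRats (cutMul (toRats x) (toRats y))

/-- The order relation of the ι-real line, as a class of ordered pairs. -/
def leRel : Set ZFSet.{0} :=
  {z | ∃ a b : RIota, a ≤ b ∧ z = ZFSet.pair (a : ZFSet.{0}) (b : ZFSet.{0})}

/-- The elements of the ι-real line that belong to the set `x`. -/
def realsIn (x : ZFSet.{0}) : Set RIota := {a | (a : ZFSet.{0}) ∈ x}

/-- The class of all nonempty ι-subsets of the ι-real line which are bounded above in it. -/
def boundedSubsets : Set ZFSet.{0} :=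
  {x | IsIotaSubset x RIota ∧ (realsIn x).Nonempty ∧ BddAbove (realsIn x)}

end IotaAnalysis

end

/-!
The rudimentary functions with parameters from `J₂` are closed under Δ₀ definitions, and they stay
so when the arguments and values are truth values, rational numbers, sets of rational numbers and
so on, each coded by a hereditary set. Every rudimentary relation on a transitive rudimentarily
closed set is definable over it, and quantification over `ℚ` is bounded because `ℚ` is an ι-set, so
the arithmetic of cuts is rudimentary and all the classes in question are ι-classes. An ι-cut is the
lower cut of a real number, and the reals obtained in this way form a subfield of `ℝ`, in which the
supremum of a bounded ι-set of cuts is its union. The bounding condition on ι-functions holds since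
the image of an ι-set under a rudimentary function is an ι-set.

The subfield generated by an ι-set is the only case in which no bounded quantifier is at hand. Every
ι-set is covered by the image of `J₁` under a rudimentary function. A field expression in the given
reals is therefore coded by an element of `J₁`, and the rational enclosures of its value are those
derivable by interval arithmetic. Elements of `J₁` are hereditarily finite and `J₁` contains all of
its finite subsets, so derivability means that some element of `J₁` is a derivation; this is a
quantification over the ι-set `J₁`. Interval arithmetic is only set up for subtraction and for
inverses of positive numbers: by Hua's identity, these operations already generate the field.
-/

noncomputable section

namespace IotaAnalysis

/-! ## Sets as codes -/

/-- Types whose elements are coded injectively by hereditary sets, so that it makes sense to ask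
whether a function between two such types is rudimentary. -/
class Coded (α : Type*) where
  /-- The set which stands for an element of the type. -/
  code : α → ZFSet.{0}
  code_injective : Function.Injective code

open Coded (code code_injective)

instance : Coded ZFSet.{0} := ⟨id, Function.injective_id⟩

/-- A proposition is coded by its truth value, which is `{∅}` or `∅`. -/
instance : Coded Prop where
  code p := ({∅} : ZFSet.{0}).sep fun _ => p
  code_injective p q h := by simpa using congrArg (∅ ∈ ·) h

instance {α β : Type*} [Coded α] [Coded β] : Coded (α × β) where
  code p := ZFSet.pair (code p.1) (code p.2)
  code_injective _ _ h :=
    Prod.ext (code_injective (ZFSet.pair_inj.1 h).1) (code_injective (ZFSet.pair_inj.1 h).2)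

instance {γ : Type*} [Small.{0} γ] [Coded γ] : Coded (Set γ) where
  code A := ZFSet.range fun c : A => code (c : γ)
  code_injective A B h := by
    ext c
    simpa [code_injective.eq_iff] using congrArg (code c ∈ ·) h

@[simp]
theorem code_zfSet (x : ZFSet.{0}) : code x = x := rfl

@[simp]
theorem mem_code_prop {p : Prop} {z : ZFSet.{0}} : z ∈ code p ↔ p ∧ z = ∅ := by
  simp [code, and_comm]

@[simp]
theorem code_prod {α β : Type*} [Coded α] [Coded β] (a : α) (b : β) :
    code (a, b) = ZFSet.pair (code a) (code b) := rfl

theorem mem_code_set {γ : Type*} [Small.{0} γ] [Coded γ] {A : Set γ} {z : ZFSet.{0}} :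
    z ∈ code A ↔ ∃ c ∈ A, code c = z := by
  simp [code]

@[simp]
theorem code_mem_code_set {γ : Type*} [Small.{0} γ] [Coded γ] {A : Set γ} {c : γ} :
    code c ∈ code A ↔ c ∈ A := by
  simp [mem_code_set, code_injective.eq_iff]

/-! ## Rudimentary functions between coded types -/

/-- The union of the sets `g y` for `y ∈ x`. -/
def biUnion (x : ZFSet.{0}) (g : ZFSet.{0} → ZFSet.{0}) : ZFSet.{0} :=
  ZFSet.iUnion fun y : x => g y

@[simp]
theorem mem_biUnion {x z : ZFSet.{0}} {g : ZFSet.{0} → ZFSet.{0}} :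
    z ∈ biUnion x g ↔ ∃ y ∈ x, z ∈ g y := by
  simp [biUnion]

/-- The set of all `g y` for `y ∈ x`. -/
def replacement (x : ZFSet.{0}) (g : ZFSet.{0} → ZFSet.{0}) : ZFSet.{0} :=
  biUnion x fun y => {g y}

@[simp]
theorem mem_replacement {x z : ZFSet.{0}} {g : ZFSet.{0} → ZFSet.{0}} :
    z ∈ replacement x g ↔ ∃ y ∈ x, z = g y := by
  simp [replacement]

theorem J1_mem_J2 : J1 ∈ J2 := (rudClosure_isLeast J1).1.2.1

theorem J1_subset_J2 : J1 ⊆ J2 := (rudClosure_isLeast J1).1.1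

theorem empty_mem_J1 : ∅ ∈ J1 := (rudClosure_isLeast ∅).1.2.1

theorem isRudClosed_J1 : IsRudClosed J1 := isRudClosed_rudClosure ∅

theorem isRudClosed_J2 : IsRudClosed J2 := isRudClosed_rudClosure J1

protected theorem IsRudClosed.eval_mem {M : ZFSet.{0}} (hM : IsRudClosed M) {k : ℕ} (t : RudTerm k)
    {v : Fin k → ZFSet.{0}} (hv : ∀ i, v i ∈ M) : t.eval v ∈ M :=
  hM k _ ⟨t, rfl⟩ v hv

section

variable {α β γ : Type*} [Coded α] [Coded β] [Coded γ]

/-- Functions between coded types which, on codes, are given by a rudimentary function with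
parameters from `J₂`. In `p`, the places for the argument are marked by `none`. -/
@[fun_prop]
def RudFun (f : α → β) : Prop :=
  ∃ (k : ℕ) (t : RudTerm k) (p : Fin k → Option J2),
    ∀ x, code (f x) = t.eval fun i => (p i).elim (code x) (↑)

@[fun_prop]
protected theorem RudFun.id : RudFun fun x : α => x := ⟨1, .proj 0, fun _ => none, fun _ => rfl⟩

protected theorem RudFun.const_of_mem {b : β} (hb : code b ∈ J2) : RudFun fun _ : α => b :=
  ⟨1, .proj 0, fun _ => some ⟨code b, hb⟩, fun _ => rfl⟩

@[fun_prop]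
protected theorem RudFun.code {f : α → β} (hf : RudFun f) : RudFun fun x => code (f x) := hf

protected theorem RudFun.congr {f g : α → β} (hf : RudFun f) (h : ∀ x, g x = f x) : RudFun g := by
  rwa [funext h]

protected theorem RudFun.of_code_eq {f : α → β} {g : α → ZFSet.{0}} (hg : RudFun g)
    (h : ∀ x, code (f x) = g x) : RudFun f :=
  show RudFun fun x => code (f x) from hg.congr h

protected theorem RudFun.code_mem_J2 {f : α → β} (hf : RudFun f) {x : α} (hx : code x ∈ J2) :
    code (f x) ∈ J2 := by
  obtain ⟨k, t, p, h⟩ := hf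
  rw [h]
  refine isRudClosed_J2.eval_mem t fun i => ?_
  cases p i with
  | none => exact hx
  | some c => exact c.2

protected theorem RudFun.eval {k : ℕ} (t : RudTerm k) {g : Fin k → α → ZFSet.{0}}
    (hg : ∀ i, RudFun (g i)) : RudFun fun x => t.eval fun i => g i x := by
  choose m s p h using hg
  let e := finSigmaFinEquiv (n := m)
  refine ⟨_, .comp t fun i => .comp (s i) fun j => .proj (e ⟨i, j⟩),
    fun l => p (e.symm l).1 (e.symm l).2, fun x => ?_⟩
  let u : (Σ i, Fin (m i)) → ZFSet.{0} := fun q => (p q.1 q.2).elim (code x) (↑)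
  change _ = t.eval fun i => (s i).eval fun j => u (e.symm (e ⟨i, j⟩))
  simp only [Equiv.symm_apply_apply]
  exact congrArg t.eval (funext fun i => h i x)

@[fun_prop]
protected theorem RudFun.comp {f : β → γ} {g : α → β} (hf : RudFun f) (hg : RudFun g) :
    RudFun fun x => f (g x) := by
  obtain ⟨k, t, p, h⟩ := hf
  refine (RudFun.eval t (g := fun i x => (p i).elim (code (g x)) (↑)) fun i => ?_).of_code_eq
    fun x => h (g x)
  cases p i with
  | none => exact hg.code
  | some c => exact .const_of_mem c.2

@[fun_prop]
protected theorem RudFun.upair {f g : α → ZFSet.{0}} (hf : RudFun f) (hg : RudFun g) :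
    RudFun fun x => ({f x, g x} : ZFSet.{0}) :=
  (RudFun.eval (.upair 0 1) (g := ![f, g]) <| Fin.forall_fin_two.2 ⟨hf, hg⟩).congr fun _ => rfl

@[fun_prop]
protected theorem RudFun.sdiff {f g : α → ZFSet.{0}} (hf : RudFun f) (hg : RudFun g) :
    RudFun fun x => f x \ g x :=
  (RudFun.eval (.diff 0 1) (g := ![f, g]) <| Fin.forall_fin_two.2 ⟨hf, hg⟩).congr fun _ => rfl

@[fun_prop]
protected theorem RudFun.sUnion {f : α → ZFSet.{0}} (hf : RudFun f) :
    RudFun fun x => ZFSet.sUnion (f x) :=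
  (RudFun.eval (.union (.proj 0)) (g := ![f]) <| Fin.forall_fin_one.2 hf).congr fun x => by
    ext z
    rw [RudTerm.eval, ZFSet.mem_iUnion]
    simp [RudTerm.eval]

protected theorem RudFun.biUnion_const {f g : α → ZFSet.{0}} (hf : RudFun f) (hg : RudFun g) :
    RudFun fun x => biUnion (f x) fun _ => g x :=
  (RudFun.eval (.union (.proj 1)) (g := ![f, g]) <| Fin.forall_fin_two.2 ⟨hf, hg⟩).congr
    fun _ => rfl

@[fun_prop]
protected theorem RudFun.sInter {f : α → ZFSet.{0}} (hf : RudFun f) :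
    RudFun fun x => ZFSet.sInter (f x) := by
  have hg : RudFun fun x => biUnion (f x) fun y => ZFSet.sUnion (f x) \ y :=
    (RudFun.eval (.union (.diff 1 0)) (g := ![f, fun x => ZFSet.sUnion (f x)]) <|
      Fin.forall_fin_two.2 ⟨hf, hf.sUnion⟩).congr fun _ => rfl
  refine (hf.sUnion.sdiff hg).congr fun x => ?_
  ext z
  rcases (f x).eq_empty_or_nonempty with h | h
  · simp [h]
  · simp only [ZFSet.mem_sInter h, ZFSet.mem_sdiff, ZFSet.mem_sUnion, mem_biUnion]
    obtain ⟨y, hy : y ∈ f x⟩ := h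
    grind

@[fun_prop]
protected theorem RudFun.union {f g : α → ZFSet.{0}} (hf : RudFun f) (hg : RudFun g) :
    RudFun fun x => f x ∪ g x :=
  (by fun_prop : RudFun fun x => ZFSet.sUnion {f x, g x}).congr fun x => by ext z; simp

@[fun_prop]
protected theorem RudFun.singleton {f : α → ZFSet.{0}} (hf : RudFun f) :
    RudFun fun x => ({f x} : ZFSet.{0}) :=
  (hf.upair hf).congr fun x => by simp

@[fun_prop]
protected theorem RudFun.prodMk {f : α → β} {g : α → γ} (hf : RudFun f) (hg : RudFun g) :
    RudFun fun x => (f x, g x) :=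
  (by fun_prop : RudFun fun x => ({{code (f x)}, {code (f x), code (g x)}} : ZFSet.{0})).of_code_eq
    fun _ => rfl

theorem sUnion_kuratowski_pair (a b : ZFSet.{0}) : ZFSet.sUnion (ZFSet.pair a b) = {a, b} := by
  ext z
  simp [ZFSet.pair]

theorem sInter_kuratowski_pair (a b : ZFSet.{0}) : ZFSet.sInter (ZFSet.pair a b) = {a} := by
  ext z
  rw [ZFSet.mem_sInter ⟨{a}, by simp [ZFSet.pair]⟩]
  simp +contextual [ZFSet.pair]

@[fun_prop]
protected theorem RudFun.fst {f : α → β × γ} (hf : RudFun f) : RudFun fun x => (f x).1 :=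
  (by fun_prop : RudFun fun x => ZFSet.sUnion (ZFSet.sInter (code (f x)))).of_code_eq fun x => by
    rw [← Prod.mk.eta (p := f x), code_prod, sInter_kuratowski_pair, ZFSet.sUnion_singleton]

@[fun_prop]
protected theorem RudFun.snd {f : α → β × γ} (hf : RudFun f) : RudFun fun x => (f x).2 := by
  -- for `f x = (a, b)` this is `{code b}` if `b ≠ a`, and empty otherwise
  let d x := ZFSet.sUnion (code (f x)) \ ZFSet.sInter (code (f x))
  have hd : RudFun d := by fun_prop
  have hg : RudFun fun x => biUnion (d x) fun _ => code (f x).1 := hd.biUnion_const hf.fst.code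
  refine (hd.sUnion.union (hf.fst.code.sdiff hg)).of_code_eq fun x => ?_
  have hdx : d x = {code (f x).1, code (f x).2} \ {code (f x).1} := by
    simp only [d]
    rw [← Prod.mk.eta (p := f x), code_prod, sInter_kuratowski_pair, sUnion_kuratowski_pair]
  by_cases h : code (f x).2 = code (f x).1
  · rw [hdx, h]
    ext z
    simp
  · have hd' : d x = {code (f x).2} := by
      rw [hdx]
      ext y
      simp only [ZFSet.mem_sdiff, ZFSet.mem_pair, ZFSet.mem_singleton]
      grind
    rw [hd']
    ext z
    simp +contextual

@[fun_prop]
protected theorem RudFun.biUnion {f : α → ZFSet.{0}} {g : α → ZFSet.{0} → ZFSet.{0}}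
    (hf : RudFun f) (hg : RudFun fun p : α × ZFSet.{0} => g p.1 p.2) :
    RudFun fun x => biUnion (f x) (g x) := by
  obtain ⟨k, t, p, h⟩ := hg
  let pairTerm : RudTerm (k + 2) := .comp (.upair 0 1) ![.upair 1 1, .upair 1 0]
  let T : RudTerm (k + 2) :=
    .union (.comp t fun i => (p i).elim pairTerm fun _ => .proj i.succ.succ)
  let b (i : Fin k) (x : α) : ZFSet.{0} := (p i).elim (code x) (↑)
  have hb i : RudFun (b i) := by
    simp only [b]
    cases p i with
    | none => exact RudFun.id.code
    | some c => exact .const_of_mem c.2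
  have hargs : ∀ i, RudFun ((Fin.cons f (Fin.cons code b) : Fin (k + 2) → α → ZFSet.{0}) i) :=
    Fin.cases hf <| Fin.cases RudFun.id.code hb
  refine (RudFun.eval T hargs).congr fun x => ?_
  refine congrArg ZFSet.iUnion (funext fun y => (h (x, (y : ZFSet.{0}))).trans ?_)
  refine congrArg t.eval (funext fun i => ?_)
  rcases hi : p i with _ | c
  · simp [hi, pairTerm, RudTerm.eval, Fin.tail, ZFSet.pair]
  · simp [RudTerm.eval, Fin.tail, b, hi]

/-! ### Rudimentary relations -/

@[fun_prop]
protected theorem RudFun.bex {f : α → ZFSet.{0}} {P : α → ZFSet.{0} → Prop} (hf : RudFun f)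
    (hP : RudFun fun p : α × ZFSet.{0} => P p.1 p.2) : RudFun fun x => ∃ y ∈ f x, P x y :=
  (by fun_prop : RudFun fun x => biUnion (f x) fun y => code (P x y)).of_code_eq fun x => by
    ext z; simp; tauto

theorem empty_mem_J2 : ∅ ∈ J2 := J1_subset_J2 empty_mem_J1

@[fun_prop]
protected theorem RudFun.empty : RudFun fun _ : α => (∅ : ZFSet.{0}) := .const_of_mem empty_mem_J2

@[fun_prop]
protected theorem RudFun.not {P : α → Prop} (hP : RudFun P) : RudFun fun x => ¬ P x :=
  (by fun_prop : RudFun fun x => {∅} \ code (P x)).of_code_eq fun x => by ext z; simp; tauto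

@[fun_prop]
protected theorem RudFun.or {P Q : α → Prop} (hP : RudFun P) (hQ : RudFun Q) :
    RudFun fun x => P x ∨ Q x :=
  (by fun_prop : RudFun fun x => code (P x) ∪ code (Q x)).of_code_eq fun x => by
    ext z; simp; tauto

@[fun_prop]
protected theorem RudFun.and {P Q : α → Prop} (hP : RudFun P) (hQ : RudFun Q) :
    RudFun fun x => P x ∧ Q x :=
  (by fun_prop : RudFun fun x => ¬ (¬ P x ∨ ¬ Q x)).congr fun x => by simp

@[fun_prop]
protected theorem RudFun.imp {P Q : α → Prop} (hP : RudFun P) (hQ : RudFun Q) :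
    RudFun fun x => P x → Q x :=
  (by fun_prop : RudFun fun x => ¬ P x ∨ Q x).congr fun x => by simp [imp_iff_not_or]

@[fun_prop]
protected theorem RudFun.subset {f g : α → ZFSet.{0}} (hf : RudFun f) (hg : RudFun g) :
    RudFun fun x => f x ⊆ g x :=
  (by fun_prop : RudFun fun x => {∅} \ biUnion (f x \ g x) fun _ => {∅}).of_code_eq fun x => by
    ext z; simp [ZFSet.subset_def]; grind

@[fun_prop]
protected theorem RudFun.eq {f g : α → β} (hf : RudFun f) (hg : RudFun g) :
    RudFun fun x => f x = g x :=
  (by fun_prop : RudFun fun x => code (f x) ⊆ code (g x) ∧ code (g x) ⊆ code (f x)).congr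
    fun x => by
      rw [eq_iff_iff, ← (code_injective (α := β)).eq_iff]
      exact ⟨fun h => ⟨h.le, h.ge⟩, fun h => ZFSet.ext fun _ => ⟨(h.1 ·), (h.2 ·)⟩⟩

@[fun_prop]
protected theorem RudFun.mem {f g : α → ZFSet.{0}} (hf : RudFun f) (hg : RudFun g) :
    RudFun fun x => f x ∈ g x :=
  (by fun_prop : RudFun fun x => {f x} ⊆ g x).congr fun x => by simp [ZFSet.subset_def]

open Classical in
@[fun_prop]
protected theorem RudFun.ite {P : α → Prop} {f g : α → β} (hP : RudFun P) (hf : RudFun f)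
    (hg : RudFun g) : RudFun fun x => if P x then f x else g x :=
  (by fun_prop : RudFun fun x => (biUnion (code (P x)) fun _ => code (f x)) ∪
    biUnion (code (¬ P x)) fun _ => code (g x)).of_code_eq fun x => by
      ext z
      by_cases h : P x <;> simp [h]

@[fun_prop]
protected theorem RudFun.sep {f : α → ZFSet.{0}} {P : α → ZFSet.{0} → Prop} (hf : RudFun f)
    (hP : RudFun fun p : α × ZFSet.{0} => P p.1 p.2) : RudFun fun x => (f x).sep (P x) :=
  (by fun_prop : RudFun fun x => biUnion (f x) fun y => biUnion (code (P x y)) fun _ => {y}).congr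
    fun x => by ext z; simp

@[fun_prop]
protected theorem RudFun.insert {f g : α → ZFSet.{0}} (hf : RudFun f) (hg : RudFun g) :
    RudFun fun x => insert (f x) (g x) :=
  (by fun_prop : RudFun fun x => {f x} ∪ g x).congr fun x => by ext z; simp

@[fun_prop]
protected theorem RudFun.pair {f g : α → ZFSet.{0}} (hf : RudFun f) (hg : RudFun g) :
    RudFun fun x => ZFSet.pair (f x) (g x) :=
  (hf.prodMk hg).code

@[fun_prop]
protected theorem RudFun.replacement {f : α → ZFSet.{0}} {g : α → ZFSet.{0} → ZFSet.{0}}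
    (hf : RudFun f) (hg : RudFun fun p : α × ZFSet.{0} => g p.1 p.2) :
    RudFun fun x => replacement (f x) (g x) :=
  (by fun_prop : RudFun fun x => biUnion (f x) fun y => {g x y})

end

/-! ### Types whose elements form an ι-set -/

/-- Coded types whose set of codes is an ι-set. A rudimentary function may depend on such a type
as on a parameter; in particular, quantification over it is bounded. -/
class SetCoded (γ : Type*) [Coded γ] : Prop where
  exists_codes : ∃ s ∈ J2, ∀ z : ZFSet.{0}, z ∈ s ↔ ∃ c : γ, code c = z

section

variable {α β γ : Type*} [Coded α] [Coded β] [Coded γ]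

variable (γ) in
/-- The set of codes of the elements of a coded type. -/
def codes [h : SetCoded γ] : ZFSet.{0} := h.exists_codes.choose

theorem codes_mem_J2 [h : SetCoded γ] : codes γ ∈ J2 := h.exists_codes.choose_spec.1

theorem mem_codes [h : SetCoded γ] {z : ZFSet.{0}} : z ∈ codes γ ↔ ∃ c : γ, code c = z :=
  h.exists_codes.choose_spec.2 z

@[fun_prop]
protected theorem RudFun.codes [SetCoded γ] : RudFun fun _ : α => codes γ :=
  .const_of_mem codes_mem_J2

protected theorem RudFun.exists_extend {f : α → β} (hf : RudFun f) :
    ∃ g : ZFSet.{0} → ZFSet.{0}, RudFun g ∧ ∀ x, g (code x) = code (f x) := by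
  obtain ⟨k, t, p, h⟩ := hf
  exact ⟨fun y => t.eval fun i => (p i).elim y (↑), ⟨k, t, p, fun _ => rfl⟩, fun x => (h x).symm⟩

@[fun_prop]
protected theorem RudFun.exists [SetCoded γ] {P : α → γ → Prop}
    (hP : RudFun fun p : α × γ => P p.1 p.2) : RudFun fun x => ∃ c, P x c := by
  obtain ⟨g, hg, h⟩ := hP.exists_extend
  exact (by fun_prop : RudFun fun x : α => ∃ y ∈ codes γ, ∅ ∈ g (code (x, y))).congr fun x => by
    have hx c : g (ZFSet.pair (code x) (code c)) = code (P x c) := h (x, c)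
    simp [mem_codes, hx]

@[fun_prop]
protected theorem RudFun.forall [SetCoded γ] {P : α → γ → Prop}
    (hP : RudFun fun p : α × γ => P p.1 p.2) : RudFun fun x => ∀ c, P x c :=
  (by fun_prop : RudFun fun x => ¬ ∃ c, ¬ P x c).congr fun x => by simp

protected theorem RudFun.of_graph [SetCoded γ] {f : α → γ}
    (hf : RudFun fun p : α × γ => f p.1 = p.2) : RudFun f := by
  obtain ⟨g, hg, h⟩ := hf.exists_extend
  have hU : RudFun fun x : α =>
      biUnion (codes γ) fun y => biUnion (g (code (x, y))) fun _ => y := by fun_prop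
  refine hU.of_code_eq fun x => ?_
  have hx c : g (ZFSet.pair (code x) (code c)) = code (f x = c) := h (x, c)
  ext z
  simp [mem_codes, hx]

protected theorem RudFun.of_comp_surjective₂ {δ : Type*} [Coded δ] [SetCoded β] [SetCoded γ]
    {op : δ → δ → β} {π : γ → δ} {g : γ × γ → β} (hπ : RudFun π) (hsurj : π.Surjective)
    (hg : RudFun g) (h : ∀ c d, op (π c) (π d) = g (c, d)) {f₁ f₂ : α → δ} (hf₁ : RudFun f₁)
    (hf₂ : RudFun f₂) : RudFun fun x => op (f₁ x) (f₂ x) := by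
  refine .of_graph <| (by fun_prop : RudFun fun p : α × β =>
    ∃ c d, π c = f₁ p.1 ∧ π d = f₂ p.1 ∧ g (c, d) = p.2).congr fun ⟨x, y⟩ => ?_
  obtain ⟨c, hc⟩ := hsurj (f₁ x)
  obtain ⟨d, hd⟩ := hsurj (f₂ x)
  grind

protected theorem RudFun.exists_range [SetCoded γ] {f : γ → β} (hf : RudFun f) :
    ∃ s ∈ J2, ∀ z, z ∈ s ↔ ∃ c, code (f c) = z := by
  obtain ⟨g, hg, h⟩ := hf.exists_extend
  have hr : RudFun fun x : ZFSet.{0} => replacement x g := by fun_prop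
  refine ⟨replacement (codes γ) g, hr.code_mem_J2 codes_mem_J2, fun z => ?_⟩
  simp [mem_codes, h, eq_comm]

protected theorem SetCoded.of_surjective [SetCoded γ] {π : γ → β} (hπ : RudFun π)
    (hsurj : π.Surjective) : SetCoded β := by
  obtain ⟨s, hs, h⟩ := hπ.exists_range
  exact ⟨s, hs, fun z => by rw [h, hsurj.exists]⟩

protected theorem IsRudClosed.upair_mem {M x y : ZFSet.{0}} (hM : IsRudClosed M) (hx : x ∈ M)
    (hy : y ∈ M) : {x, y} ∈ M :=
  show (RudTerm.upair 0 1).eval ![x, y] ∈ M from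
    hM.eval_mem _ <| Fin.forall_fin_two.2 ⟨hx, hy⟩

protected theorem IsRudClosed.pair_mem {M x y : ZFSet.{0}} (hM : IsRudClosed M) (hx : x ∈ M)
    (hy : y ∈ M) : ZFSet.pair x y ∈ M :=
  hM.upair_mem (ZFSet.pair_eq_singleton x ▸ hM.upair_mem hx hx) (hM.upair_mem hx hy)

protected theorem IsRudClosed.union_mem {M x y : ZFSet.{0}} (hM : IsRudClosed M) (hx : x ∈ M)
    (hy : y ∈ M) : x ∪ y ∈ M := by
  convert! hM.eval_mem (.union (.proj 0)) (v := ![{x, y}]) <| Fin.forall_fin_one.2 <|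
    hM.upair_mem hx hy using 1
  ext z
  rw [RudTerm.eval, ZFSet.mem_iUnion]
  simp [RudTerm.eval]

protected theorem IsRudClosed.insert_mem {M x y : ZFSet.{0}} (hM : IsRudClosed M) (hx : x ∈ M)
    (hy : y ∈ M) : insert x y ∈ M := by
  convert! hM.union_mem (hM.upair_mem hx hx) hy using 1
  ext z
  simp

instance [SetCoded β] [SetCoded γ] : SetCoded (β × γ) := by
  have h : RudFun fun p : ZFSet.{0} × ZFSet.{0} =>
      biUnion p.1 fun a => replacement p.2 fun b => ZFSet.pair a b := by fun_prop
  refine ⟨_, h.code_mem_J2 (x := (codes β, codes γ))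
    (isRudClosed_J2.pair_mem codes_mem_J2 codes_mem_J2), fun z => ?_⟩
  simp [mem_codes, eq_comm]

end

section

variable {α γ : Type*} [Coded α] [Coded γ] [Small.{0} γ]

@[fun_prop]
protected theorem RudFun.setOf [SetCoded γ] {P : α → γ → Prop}
    (hP : RudFun fun p : α × γ => P p.1 p.2) : RudFun fun x => {c | P x c} := by
  have h : RudFun fun x => (codes γ).sep fun z => ∃ c : γ, P x c ∧ code c = z := by fun_prop
  refine h.of_code_eq fun x => ?_
  ext z
  simp only [mem_code_set, mem_codes, ZFSet.mem_sep, Set.mem_ofPred_eq]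
  grind

@[fun_prop]
protected theorem RudFun.mem_set {f : α → γ} {A : α → Set γ} (hf : RudFun f) (hA : RudFun A) :
    RudFun fun x => f x ∈ A x :=
  (by fun_prop : RudFun fun x => code (f x) ∈ code (A x)).congr fun x => by simp

end

/-! ## Transitivity of `J₂` and definability of rudimentary relations -/

theorem IsRudClosed.hereditarily_eval {M : ZFSet.{0}} (hM : IsRudClosed M) {n : ℕ} (t : RudTerm n)
    {v : Fin n → ZFSet.{0}} (hv : ∀ i, (v i).Hereditarily (· ∈ M)) :
    (t.eval v).Hereditarily (· ∈ M) := by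
  have of_mem {m : ℕ} (s : RudTerm m) {w : Fin m → ZFSet.{0}} (hw : ∀ i, (w i).Hereditarily (· ∈ M))
      (h : ∀ y ∈ s.eval w, y.Hereditarily (· ∈ M)) : (s.eval w).Hereditarily (· ∈ M) :=
    ZFSet.hereditarily_iff.2 ⟨hM.eval_mem s fun i => (hw i).self, h⟩
  induction t with
  | proj i => exact hv i
  | upair i j =>
    refine of_mem _ hv fun y hy => ?_
    rcases ZFSet.mem_pair.1 hy with rfl | rfl <;> exact hv _
  | diff i j => exact of_mem _ hv fun y hy => (hv i).mem (ZFSet.mem_sdiff.1 hy).1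
  | comp _ _ ihG ihH => exact ihG fun i => ihH i hv
  | union H ih =>
    refine of_mem _ hv fun y hy => ?_
    obtain ⟨⟨w, hw⟩, h⟩ := ZFSet.mem_iUnion.1 hy
    refine (ih ?_).mem h
    exact Fin.cases ((hv 0).mem hw) fun i => hv i.succ

theorem isTransitive_rudClosure {u : ZFSet.{0}} (hu : u.IsTransitive) :
    (rudClosure u).IsTransitive := by
  have hmem : ∀ z ∈ u, z.Hereditarily (· ∈ rudClosure u) := fun z =>
    ZFSet.inductionOn z fun z ih hz => ZFSet.hereditarily_iff.2
      ⟨(rudClosure_isLeast u).1.1 hz, fun y hy => ih y hy (hu.mem_trans hy hz)⟩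
  have hself : u.Hereditarily (· ∈ rudClosure u) :=
    ZFSet.hereditarily_iff.2 ⟨(rudClosure_isLeast u).1.2.1, hmem⟩
  intro z hz y hy
  obtain ⟨n, t, v, hv, rfl⟩ := mem_rudClosure.1 hz
  refine (((isRudClosed_rudClosure u).hereditarily_eval t fun i => ?_).mem hy).self
  rcases ZFSet.mem_insert_iff.1 (hv i) with h | h
  · rwa [h]
  · exact hmem _ h

theorem isTransitive_J1 : J1.IsTransitive := isTransitive_rudClosure ZFSet.isTransitive_empty

theorem isTransitive_J2 : J2.IsTransitive := isTransitive_rudClosure isTransitive_J1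

theorem mem_J2_of_mem {x y : ZFSet.{0}} (hx : x ∈ y) (hy : y ∈ J2) : x ∈ J2 :=
  isTransitive_J2.mem_trans hx hy

@[fun_prop]
protected theorem RudFun.const {α γ : Type*} [Coded α] [Coded γ] [SetCoded γ] (c : γ) :
    RudFun fun _ : α => c :=
  .const_of_mem <| mem_J2_of_mem (mem_codes.2 ⟨c, rfl⟩) codes_mem_J2

section

variable {α γ : Type*} [Coded α] [Coded γ] [Nonempty γ]

/-- The element with a given code (and an arbitrary element if there is none). -/
def decode : ZFSet.{0} → γ := Function.invFun code

@[simp]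
theorem decode_code (c : γ) : decode (code c) = c :=
  Function.leftInverse_invFun code_injective c

theorem decode_eq_iff {z : ZFSet.{0}} {c : γ} :
    decode z = c ↔ code c = z ∨ (¬ ∃ d : γ, code d = z) ∧ c = Classical.arbitrary γ := by
  by_cases h : ∃ d : γ, code d = z
  · obtain ⟨d, rfl⟩ := h
    simp [code_injective.eq_iff, eq_comm]
  · have hz : decode z = Classical.arbitrary γ := Function.invFun_neg h
    grind

@[fun_prop]
protected theorem RudFun.decode [SetCoded γ] {f : α → ZFSet.{0}} (hf : RudFun f) :
    RudFun fun x => (decode (f x) : γ) :=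
  .of_graph <| (by fun_prop : RudFun fun p : α × γ =>
    code p.2 = f p.1 ∨ (¬ ∃ d : γ, code d = f p.1) ∧ p.2 = Classical.arbitrary γ).congr
      fun _ => propext decode_eq_iff

end

section

open FirstOrder Set

variable {α : Type} {M : ZFSet.{0}}

/-- Definability over `M`, with arbitrary parameters, of a relation in the variables `α`. -/
abbrev DefinableOver (S : Set (α → M)) : Prop := (Set.univ : Set M).Definable setLanguage S

/-- Definability over `M`, with arbitrary parameters, of a function of the variables `α`. -/
abbrev DefinableFunOver (f : (α → M) → M) : Prop :=
  (Set.univ : Set M).DefinableFun setLanguage f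

theorem DefinableFunOver.mem {f g : (α → M) → M} (hf : DefinableFunOver f)
    (hg : DefinableFunOver g) :
    DefinableOver {v : α → M | (f v : ZFSet.{0}) ∈ (g v : ZFSet.{0})} := by
  have hmem : DefinableOver {v : Fin 2 → M | (v 0 : ZFSet.{0}) ∈ (v 1 : ZFSet.{0})} := by
    let r : setLanguage[[(Set.univ : Set M)]].Relations 2 := Sum.inl SetRel.mem
    refine ⟨r.formula₂ (Language.Term.var 0) (Language.Term.var 1), ?_⟩
    ext v
    have hr : (r.formula₂ (Language.Term.var 0) (Language.Term.var 1)).Realize v ↔ _ :=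
      Language.Formula.realize_rel₂
    rw [Set.mem_ofPred_eq, Set.mem_ofPred_eq, hr]
    rfl
  have hfg : Set.DefinableMap setLanguage Set.univ fun v => ![f v, g v] := by
    simp [Set.DefinableMap, *]
  exact hmem.preimage_map hfg

theorem DefinableOver.exists {S : (α → M) → M → Prop}
    (h : DefinableOver {w : Option α → M | S (w ∘ some) (w none)}) :
    DefinableOver {v : α → M | ∃ u, S v u} := by
  convert! (h.preimage_comp fun o : Option α =>
    o.elim (Sum.inr ()) Sum.inl).exists_of_finite using 1
  ext v
  exact ⟨fun ⟨u, h⟩ => ⟨fun _ => u, h⟩, fun ⟨u, h⟩ => ⟨u (), h⟩⟩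

theorem DefinableOver.definableFunOver {f : (α → M) → M} (hM : M.IsTransitive)
    (h : DefinableOver {w : Option α → M | (w none : ZFSet.{0}) ∈ (f (w ∘ some) : ZFSet.{0})}) :
    DefinableFunOver f := by
  let S (w : Option α → M) (u : M) : Prop :=
    ¬ ((u : ZFSet.{0}) ∈ (w none : ZFSet.{0}) ↔ (u : ZFSet.{0}) ∈ (f (w ∘ some) : ZFSet.{0}))
  have hne : DefinableOver {w : Option α → M | ∃ u : M, S w u} := by
    refine DefinableOver.exists ?_
    have h₁ : DefinableOver {w : Option (Option α) → M |
        (w none : ZFSet.{0}) ∈ (w (some none) : ZFSet.{0})} :=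
      DefinableFunOver.mem (.proj _) (.proj _)
    have h₂ := h.preimage_comp fun o : Option α => o.elim none fun a => some (some a)
    convert! (h₁.inter h₂.compl).union (h₂.inter h₁.compl) using 1
    ext w
    exact not_iff.trans (by simp only [mem_union, mem_inter_iff, mem_compl_iff]; tauto)
  change DefinableOver _
  convert! hne.compl using 1
  ext w
  simp only [S, Function.tupleGraph, Set.mem_ofPred_eq, mem_compl_iff, not_exists, not_not]
  refine ⟨fun h u => by rw [← h], fun h => Subtype.ext (ZFSet.ext fun z => ?_)⟩
  exact ⟨fun hz => (h ⟨z, hM.mem_trans hz (f (w ∘ some)).2⟩).2 hz,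
    fun hz => (h ⟨z, hM.mem_trans hz (w none).2⟩).1 hz⟩

/-- The function described by a construction term, as an operation on the elements of a
rudimentarily closed set. -/
def RudTerm.evalIn (hM : IsRudClosed M) {k : ℕ} (t : RudTerm k) (v : Fin k → M) : M :=
  ⟨t.eval fun i => v i, hM.eval_mem t fun i => (v i).2⟩

theorem RudTerm.definableFunOver_evalIn (hM : IsRudClosed M) (hM' : M.IsTransitive) {k : ℕ}
    (t : RudTerm k) : DefinableFunOver (t.evalIn hM) := by
  have hproj {β : Type} (i : β) : DefinableFunOver fun v : β → M => v i :=
    Set.DefinableFun.proj _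
  induction t with
  | proj i => exact hproj i
  | @upair n i j =>
    refine DefinableOver.definableFunOver hM' ?_
    have heq i : DefinableOver {w : Option (Fin n) → M | w none = w (some i)} :=
      Set.DefinableFun.ofPred_eq (hproj _) (hproj _)
    convert! (heq i).union (heq j) using 1
    ext w
    simp only [evalIn, eval, Set.mem_ofPred_eq, ZFSet.mem_pair, Set.mem_union, Subtype.ext_iff,
      Function.comp_apply]
  | diff i j =>
    refine DefinableOver.definableFunOver hM' ?_
    convert! ((hproj none).mem (hproj (some i))).inter
      ((hproj none).mem (hproj (some j))).compl using 1
    ext w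
    simp [evalIn, eval]
  | comp G H ihG ihH => exact Set.DefinableFun.comp (g := fun v i => (H i).evalIn hM v) ihH ihG
  | @union n H ih =>
    refine DefinableOver.definableFunOver hM' ?_
    have hH : DefinableFunOver fun w : Option (Option (Fin (n + 1))) → M =>
        H.evalIn hM (Fin.cons (w none) fun i => w (some (some i.succ))) :=
      Set.DefinableFun.comp (Fin.cases (hproj _) fun i => hproj _) ih
    convert! DefinableOver.exists (S := fun (w : Option (Fin (n + 1)) → M) y =>
      (y : ZFSet.{0}) ∈ (w (some 0) : ZFSet.{0}) ∧ (w none : ZFSet.{0}) ∈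
        (H.evalIn hM (Fin.cons y fun i => w (some i.succ)) : ZFSet.{0}))
      (((hproj none).mem (hproj (some (some 0)))).inter ((hproj (some none)).mem hH)) using 1
    ext w
    have hcons (y : M) : (fun i => ((Fin.cons y fun i => w (some i.succ) : Fin (n + 1) → M) i :
        ZFSet.{0})) = Fin.cons (y : ZFSet.{0}) fun i => (w (some i.succ) : ZFSet.{0}) :=
      funext (Fin.cases rfl fun _ => rfl)
    simp only [evalIn, eval, Set.mem_ofPred_eq, hcons]
    rw [ZFSet.mem_iUnion]
    exact ⟨fun ⟨⟨y, hy⟩, h⟩ => ⟨⟨y, hM'.mem_trans hy (w (some 0)).2⟩, hy, h⟩,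
      fun ⟨y, hy, h⟩ => ⟨⟨y, hy⟩, h⟩⟩

end

protected theorem RudFun.definable {P : ZFSet.{0} → Prop} (hP : RudFun P) :
    (Set.univ : Set J2).Definable₁ setLanguage {a : J2 | P a} := by
  obtain ⟨k, t, p, h⟩ := hP
  let f (v : Fin 1 → J2) : J2 := t.evalIn isRudClosed_J2 fun i => (p i).elim (v 0) id
  have hf : DefinableFunOver f := by
    refine Set.DefinableFun.comp (fun i => ?_)
      (t.definableFunOver_evalIn isRudClosed_J2 isTransitive_J2)
    cases p i with
    | none => exact Set.DefinableFun.proj _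
    | some c => exact setLanguage.definableFun_const _ (Set.mem_univ c)
  have hcode v : (f v : ZFSet.{0}) = code (P (v 0)) := by
    refine (congrArg t.eval (funext fun i => ?_)).trans (h (v 0)).symm
    rcases hi : p i with _ | c <;> simp [hi]
  change DefinableOver _
  convert! DefinableFunOver.mem (f := fun _ => ⟨∅, empty_mem_J2⟩)
    (setLanguage.definableFun_const _ (Set.mem_univ _)) hf using 1
  ext v
  simp [hcode]

theorem RudFun.isIotaClass {P : ZFSet.{0} → Prop} (hP : RudFun P) :
    IsIotaClass {x | x ∈ J2 ∧ P x} := by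
  refine ⟨⟨fun _ hx => hx.1, ?_⟩, fun z hz => ?_⟩
  · convert! hP.definable using 1
    ext x
    simp
  · have hsep : RudFun fun z : ZFSet.{0} => z.sep P := by fun_prop
    convert! hsep.code_mem_J2 (x := z) hz using 1
    ext x
    simp only [ZFSet.mem_sep, Set.mem_ofPred_eq, code_zfSet]
    exact ⟨fun h => ⟨h.1, h.2.2⟩, fun h => ⟨h.1, mem_J2_of_mem h.1 hz, h.2⟩⟩

/-! ## Rudimentary images of `J₁` -/

/-- Coded types whose codes belong to `J₁`. -/
class J1Coded (γ : Type*) [Coded γ] : Prop where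
  code_mem_J1 : ∀ c : γ, code c ∈ J1

instance : Coded J1 := ⟨Subtype.val, Subtype.val_injective⟩

instance : J1Coded J1 := ⟨Subtype.prop⟩

instance : SetCoded J1 :=
  ⟨J1, J1_mem_J2, fun z => ⟨fun h => ⟨⟨z, h⟩, rfl⟩, fun ⟨c, hc⟩ => hc ▸ c.2⟩⟩

instance : Nonempty J1 := ⟨⟨∅, empty_mem_J1⟩⟩

theorem code_true : code True = {∅} := by ext; simp

theorem code_false : code False = ∅ := by ext; simp

instance : J1Coded Prop := ⟨fun p => by
  by_cases h : p
  · simpa [h, code_true] using isRudClosed_J1.upair_mem empty_mem_J1 empty_mem_J1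
  · simpa [h, code_false] using empty_mem_J1⟩

instance : SetCoded Prop := ⟨{∅, {∅}}, isRudClosed_J2.upair_mem empty_mem_J2
  (J1_subset_J2 (code_true ▸ J1Coded.code_mem_J1 True)), fun z => by
    simp [Prop.exists, code_true, code_false, eq_comm, or_comm]⟩

section

variable {α β γ : Type*} [Coded α] [Coded β] [Coded γ] [J1Coded β] [J1Coded γ]

instance : J1Coded (β × γ) :=
  ⟨fun p => isRudClosed_J1.pair_mem (J1Coded.code_mem_J1 p.1) (J1Coded.code_mem_J1 p.2)⟩

/-- The code of an element of a type whose codes belong to `J₁`. -/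
def inJ1 (c : γ) : J1 := ⟨code c, J1Coded.code_mem_J1 c⟩

theorem inJ1_injective : Function.Injective (inJ1 : γ → J1) :=
  fun _ _ h => code_injective (Subtype.ext_iff.1 h)

@[simp]
theorem inJ1_inj {c d : γ} : inJ1 c = inJ1 d ↔ c = d := inJ1_injective.eq_iff

@[fun_prop]
protected theorem RudFun.inJ1 {f : α → γ} (hf : RudFun f) : RudFun fun x => inJ1 (f x) := hf

@[simp]
theorem code_inJ1 (c : γ) : code (inJ1 c) = code c := rfl

end

theorem exists_rudFun_tuple (n : ℕ) :
    ∃ c : Fin n → J1 → J1, (∀ i, RudFun (c i)) ∧ ∀ v : Fin n → J1, ∃ s, ∀ i, c i s = v i := by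
  induction n with
  | zero => exact ⟨Fin.elim0, fun i => i.elim0, fun _ => ⟨⟨∅, empty_mem_J1⟩, fun i => i.elim0⟩⟩
  | succ n ih =>
    obtain ⟨c, hc, h⟩ := ih
    let head (s : J1) : J1 := (decode (code s) : J1 × J1).1
    let tail (i : Fin n) (s : J1) : J1 := c i (decode (code s) : J1 × J1).2
    have hhead : RudFun head := by fun_prop
    have htail i : RudFun (tail i) := (hc i).comp (by fun_prop)
    refine ⟨Fin.cons head tail, Fin.cases hhead htail, fun v => ?_⟩
    obtain ⟨s, hs⟩ := h (Fin.tail v)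
    exact ⟨inJ1 (v 0, s), Fin.cases (by simp [head, -code_prod]) fun i => by
      simp [tail, hs, Fin.tail, -code_prod]⟩

/-- A class of sets is coverable if it is included in a rudimentary image of `J₁`. -/
def IsCoverable (X : Set ZFSet.{0}) : Prop :=
  ∃ h : J1 → ZFSet.{0}, RudFun h ∧ X ⊆ Set.range h

namespace IsCoverable

variable {X Y : Set ZFSet.{0}}

theorem of_rudFun {γ : Type*} [Coded γ] [SetCoded γ] [J1Coded γ] [Nonempty γ] {h : γ → ZFSet.{0}}
    (hh : RudFun h) (hX : X ⊆ Set.range h) : IsCoverable X :=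
  ⟨fun s => h (decode (code s)), by fun_prop, fun z hz => by
    obtain ⟨c, rfl⟩ := hX hz
    exact ⟨inJ1 c, by simp⟩⟩

theorem union (hX : IsCoverable X) (hY : IsCoverable Y) : IsCoverable (X ∪ Y) := by
  classical
  obtain ⟨h, hh, hXh⟩ := hX
  obtain ⟨g, hg, hYg⟩ := hY
  have hf : RudFun fun p : Prop × J1 => if p.1 then h p.2 else g p.2 := by fun_prop
  refine of_rudFun hf ?_
  rintro z (hz | hz)
  · obtain ⟨s, rfl⟩ := hXh hz
    exact ⟨(True, s), if_pos trivial⟩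
  · obtain ⟨s, rfl⟩ := hYg hz
    exact ⟨(False, s), if_neg not_false⟩

theorem iUnion_fin {k : ℕ} {X : Fin k → Set ZFSet.{0}} (hX : ∀ i, IsCoverable (X i)) :
    IsCoverable (⋃ i, X i) := by
  induction k with
  | zero => exact ⟨fun _ => ∅, .empty, by simp⟩
  | succ k ih =>
    have hcons : ⋃ i, X i = X 0 ∪ ⋃ i : Fin k, X i.succ := by
      ext z
      simp [Fin.exists_fin_succ]
    exact hcons ▸ (hX 0).union (ih fun i => hX i.succ)

theorem image_eval (hX : IsCoverable X) {n : ℕ} (t : RudTerm n) :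
    IsCoverable {z | ∃ v, (∀ i, v i ∈ X) ∧ t.eval v = z} := by
  obtain ⟨h, hh, hXh⟩ := hX
  obtain ⟨c, hc, htuple⟩ := exists_rudFun_tuple n
  refine ⟨fun s => t.eval fun i => h (c i s), .eval t fun i => hh.comp (hc i), ?_⟩
  rintro _ ⟨v, hv, rfl⟩
  choose w hw using fun i => hXh (hv i)
  obtain ⟨s, hs⟩ := htuple w
  exact ⟨s, by simp only [hs, hw]⟩

end IsCoverable

theorem RudTerm.exists_isCoverable_of_subset {n : ℕ} (t : RudTerm n) {X Y : Set ZFSet.{0}}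
    (hX : IsCoverable X) (hY : IsCoverable Y) (hY' : ∀ y ∈ Y, ∀ z ∈ y, z ∈ Y) (hXY : X ⊆ Y)
    (h : ∀ v, (∀ i, v i ∈ X) → ∀ y ∈ t.eval v, y ∈ Y) :
    ∃ Z, IsCoverable Z ∧ (∀ y ∈ Z, ∀ z ∈ y, z ∈ Z) ∧ X ⊆ Z ∧
      ∀ v, (∀ i, v i ∈ X) → t.eval v ∈ Z := by
  refine ⟨_, hY.union (hX.image_eval t), ?_, hXY.trans Set.subset_union_left,
    fun v hv => .inr ⟨v, hv, rfl⟩⟩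
  rintro _ (hy | ⟨v, hv, rfl⟩) z hz
  exacts [.inl (hY' _ hy z hz), .inl (h v hv z hz)]

theorem RudTerm.exists_isCoverable {n : ℕ} (t : RudTerm n) {X : Set ZFSet.{0}}
    (hX : IsCoverable X) (hX' : ∀ y ∈ X, ∀ z ∈ y, z ∈ X) :
    ∃ Y, IsCoverable Y ∧ (∀ y ∈ Y, ∀ z ∈ y, z ∈ Y) ∧ X ⊆ Y ∧
      ∀ v, (∀ i, v i ∈ X) → t.eval v ∈ Y := by
  induction t generalizing X with
  | proj i => exact ⟨X, hX, hX', subset_rfl, fun v hv => hv i⟩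
  | upair i j =>
    refine exists_isCoverable_of_subset _ hX hX hX' subset_rfl fun v hv y hy => ?_
    rcases ZFSet.mem_pair.1 hy with rfl | rfl <;> exact hv _
  | diff i j =>
    exact exists_isCoverable_of_subset _ hX hX hX' subset_rfl fun v hv y hy =>
      hX' _ (hv i) y (ZFSet.mem_sdiff.1 hy).1
  | @comp _ k G H ihG ihH =>
    choose Y hY hY' _ hH using fun i => ihH i hX hX'
    obtain ⟨Z, hZ, hZ', hYZ, hG⟩ := ihG (hX.union (.iUnion_fin hY)) (by
      simp only [Set.mem_union, Set.mem_iUnion]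
      grind)
    refine ⟨Z, hZ, hZ', Set.subset_union_left.trans hYZ, fun v hv => hG _ fun i => ?_⟩
    exact .inr (Set.mem_iUnion.2 ⟨i, hH i v hv⟩)
  | union H ih =>
    obtain ⟨Y, hY, hY', hXY, hH⟩ := ih hX hX'
    refine exists_isCoverable_of_subset _ hX hY hY' hXY fun v hv y hy => ?_
    obtain ⟨⟨w, hw⟩, h⟩ := ZFSet.mem_iUnion.1 hy
    exact hY' _ (hH _ (Fin.cases (hX' _ (hv 0) w hw) fun i => hv i.succ)) y h

theorem isCoverable_of_mem_J2 {z : ZFSet.{0}} (hz : z ∈ J2) : IsCoverable (z : Set ZFSet.{0}) := by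
  obtain ⟨n, t, v, hv, rfl⟩ := mem_rudClosure.1 hz
  have hJ1 : IsCoverable ((J1 : Set ZFSet.{0}) ∪ {J1}) :=
    .union ⟨fun s => code s, by fun_prop, fun z hz => ⟨⟨z, hz⟩, rfl⟩⟩
      ⟨fun _ => J1, .const_of_mem J1_mem_J2, by rintro _ rfl; exact ⟨⟨∅, empty_mem_J1⟩, rfl⟩⟩
  obtain ⟨Y, ⟨h, hh, hYh⟩, hY, -, ht⟩ := t.exists_isCoverable hJ1 <| by
    rintro y (hy | rfl) z hz
    exacts [.inl (isTransitive_J1.mem_trans hz hy), .inl hz]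
  refine ⟨h, hh, fun y hy => hYh (hY _ (ht v fun i => ?_) y hy)⟩
  exact (ZFSet.mem_insert_iff.1 (hv i)).symm

theorem exists_surjective_rudFun (γ : Type*) [Coded γ] [SetCoded γ] [Nonempty γ] :
    ∃ π : J1 → γ, RudFun π ∧ π.Surjective := by
  obtain ⟨h, hh, hcov⟩ := isCoverable_of_mem_J2 (codes_mem_J2 (γ := γ))
  refine ⟨fun s => decode (h s), by fun_prop, fun c => ?_⟩
  obtain ⟨s, hs⟩ := hcov (mem_codes.2 ⟨c, rfl⟩)
  exact ⟨s, (congrArg decode hs).trans (decode_code c)⟩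

theorem exists_rudFun_range_eq {x : ZFSet.{0}} (hx : x ∈ J2) (hne : x.Nonempty) :
    ∃ h : J1 → ZFSet.{0}, RudFun h ∧ Set.range h = x := by
  classical
  obtain ⟨h, hh, hcov⟩ := isCoverable_of_mem_J2 hx
  obtain ⟨y, hy⟩ := hne
  have hx' : RudFun fun _ : J1 => x := .const_of_mem hx
  have hy' : RudFun fun _ : J1 => y := .const_of_mem (mem_J2_of_mem hy hx)
  refine ⟨fun s => if h s ∈ x then h s else y, by fun_prop, Set.Subset.antisymm ?_ fun z hz => ?_⟩
  · rintro _ ⟨s, rfl⟩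
    dsimp only
    split_ifs with hs
    exacts [hs, hy]
  · obtain ⟨s, rfl⟩ := hcov hz
    exact ⟨s, if_pos hz⟩

/-! ## Natural numbers -/

theorem mem_natCode {x : ZFSet.{0}} {n : ℕ} : x ∈ natCode n ↔ ∃ m < n, natCode m = x := by
  induction n with
  | zero => simp [natCode]
  | succ n ih =>
    simp only [natCode, ZFSet.mem_insert_iff, ih, Nat.lt_succ_iff_lt_or_eq]
    grind

theorem natCode_injective : Function.Injective natCode := by
  have hne {m n : ℕ} (h : m < n) : natCode n ≠ natCode m :=
    ne_of_mem_of_not_mem' (mem_natCode.2 ⟨_, h, rfl⟩) (ZFSet.mem_irrefl _)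
  intro m n h
  rcases lt_trichotomy m n with hmn | hmn | hmn
  exacts [(hne hmn h.symm).elim, hmn, (hne hmn h).elim]

instance : Coded ℕ := ⟨natCode, natCode_injective⟩

instance : J1Coded ℕ where
  code_mem_J1 n := by
    induction n with
    | zero => exact empty_mem_J1
    | succ n ih => exact isRudClosed_J1.insert_mem ih ih

theorem isTransitive_natCode (n : ℕ) : (natCode n).IsTransitive := fun y hy z hz => by
  obtain ⟨m, hm, rfl⟩ := mem_natCode.1 hy
  obtain ⟨k, hk, rfl⟩ := mem_natCode.1 hz
  exact mem_natCode.2 ⟨k, hk.trans hm, rfl⟩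

/-- Bounded existential quantifiers and negation make the right-hand side visibly rudimentary. -/
theorem exists_natCode_eq_iff {x : ZFSet.{0}} : (∃ n, natCode n = x) ↔
    (¬ ∃ y ∈ x, ¬ y ⊆ x) ∧ ¬ ∃ m ∈ insert x x, ¬ (m = ∅ ∨ ∃ k ∈ m, m = insert k k) := by
  push Not
  constructor
  · rintro ⟨n, rfl⟩
    refine ⟨isTransitive_natCode n, fun m hm => ?_⟩
    obtain ⟨_ | k, -, rfl⟩ := mem_natCode.1 (show m ∈ natCode (n + 1) from hm)
    · exact .inl rfl
    · exact .inr ⟨natCode k, ZFSet.mem_insert _ _, rfl⟩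
  · refine ZFSet.inductionOn x fun x ih ⟨ht, hx⟩ => ?_
    rcases hx x (ZFSet.mem_insert _ _) with rfl | ⟨k, hk, hxk⟩
    · exact ⟨0, rfl⟩
    · have hkt : ∀ y ∈ k, y ⊆ k := fun y hy z hz => by
        have hzx : z ∈ insert k k := hxk ▸ ht y (ht k hk hy) hz
        exact (ZFSet.mem_insert_iff.1 hzx).resolve_left fun h => ZFSet.mem_asymm hy (h ▸ hz)
      obtain ⟨n, rfl⟩ := ih k hk ⟨hkt, fun m hm => hx m (ZFSet.mem_insert_of_mem _ (hxk ▸ hm))⟩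
      exact ⟨n + 1, hxk.symm⟩

instance : SetCoded ℕ := by
  have h : RudFun fun x : ZFSet.{0} => x.sep fun x =>
      (¬ ∃ y ∈ x, ¬ y ⊆ x) ∧ ¬ ∃ m ∈ insert x x, ¬ (m = ∅ ∨ ∃ k ∈ m, m = insert k k) := by
    fun_prop
  refine ⟨_, h.code_mem_J2 (x := J1) J1_mem_J2, fun z => ?_⟩
  rw [code_zfSet, ZFSet.mem_sep, ← exists_natCode_eq_iff]
  refine and_iff_right_of_imp ?_
  rintro ⟨n, rfl⟩
  exact J1Coded.code_mem_J1 n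

@[fun_prop]
protected theorem RudFun.succ {α : Type*} [Coded α] {f : α → ℕ} (hf : RudFun f) :
    RudFun fun x => (f x).succ :=
  (by fun_prop : RudFun fun x => insert (code (f x)) (code (f x))).of_code_eq fun _ => rfl

section

variable {γ : Type*} [Coded γ]

/-- The set `c` witnesses a computation of the iterates of `G` on `b`: each pair `(n, k)` in `c` is
`(0, b)` or arises from another pair in `c` by incrementing `n` and applying `G`. -/
def IsTrace (b : γ) (G : γ → γ) (c : ZFSet.{0}) : Prop :=
  ∀ (n : ℕ) (k : γ), code (n, k) ∈ c →
    (n = 0 ∧ k = b) ∨ ∃ n' k', n = Nat.succ n' ∧ k = G k' ∧ code (n', k') ∈ c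

theorem IsTrace.eq_iterate {b : γ} {G : γ → γ} {c : ZFSet.{0}} (hc : IsTrace b G c) {n : ℕ} {k : γ}
    (h : code (n, k) ∈ c) : k = G^[n] b := by
  induction n generalizing k with
  | zero => simpa using hc 0 k h
  | succ n ih =>
    obtain ⟨n', k', hn, rfl, hk'⟩ := (hc _ k h).resolve_left (by simp)
    obtain rfl : n = n' := by simpa using hn
    rw [ih hk', Function.iterate_succ_apply']

theorem exists_isTrace [J1Coded γ] (b : γ) (G : γ → γ) (n : ℕ) :
    ∃ c ∈ J1, IsTrace b G c ∧ code (n, G^[n] b) ∈ c := by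
  induction n with
  | zero =>
    refine ⟨insert (code (0, b)) ∅, isRudClosed_J1.insert_mem (J1Coded.code_mem_J1 _) empty_mem_J1,
      fun n k h => .inl ?_, by simp⟩
    have h' : code (n, k) = code (0, b) := by simpa using h
    exact Prod.ext_iff.1 (code_injective h')
  | succ n ih =>
    obtain ⟨c, hc, htrace, hn⟩ := ih
    refine ⟨insert (code (n + 1, G^[n + 1] b)) c,
      isRudClosed_J1.insert_mem (J1Coded.code_mem_J1 _) hc, fun m k h => ?_, by simp⟩
    rcases ZFSet.mem_insert_iff.1 h with h | h
    · obtain ⟨rfl, rfl⟩ := Prod.ext_iff.1 (code_injective h)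
      exact .inr ⟨n, _, rfl, Function.iterate_succ_apply' .., ZFSet.mem_insert_of_mem _ hn⟩
    · refine (htrace m k h).imp_right ?_
      rintro ⟨m', k', rfl, rfl, h'⟩
      exact ⟨m', k', rfl, rfl, ZFSet.mem_insert_of_mem _ h'⟩

protected theorem RudFun.iterate {α : Type*} [Coded α] [SetCoded γ] [J1Coded γ] {G : α → γ → γ}
    {n : α → ℕ} {b : α → γ} (hG : RudFun fun p : α × γ => G p.1 p.2) (hn : RudFun n)
    (hb : RudFun b) : RudFun fun x => (G x)^[n x] (b x) := by
  have hR : RudFun fun p : α × γ =>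
      ∃ c : J1, IsTrace (b p.1) (G p.1) (code c) ∧ code (n p.1, p.2) ∈ code c := by
    unfold IsTrace
    fun_prop
  refine .of_graph <| hR.congr fun ⟨x, k⟩ => propext ⟨?_, ?_⟩
  · rintro (rfl : (G x)^[n x] (b x) = k)
    obtain ⟨c, hc, htrace, h⟩ := exists_isTrace (b x) (G x) (n x)
    exact ⟨⟨c, hc⟩, htrace, h⟩
  · rintro ⟨c, htrace, h⟩
    exact (htrace.eq_iterate h).symm

end

section

variable {α : Type*} [Coded α]

@[fun_prop]
protected theorem RudFun.natAdd {f g : α → ℕ} (hf : RudFun f) (hg : RudFun g) :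
    RudFun fun x => f x + g x :=
  (RudFun.iterate (G := fun _ => Nat.succ) (by fun_prop) hg hf).congr fun x => by
    simp [Nat.succ_iterate]

@[fun_prop]
protected theorem RudFun.natMul {f g : α → ℕ} (hf : RudFun f) (hg : RudFun g) :
    RudFun fun x => f x * g x :=
  (RudFun.iterate (G := fun x => (· + f x)) (b := fun _ => 0) (by fun_prop) hg (.const 0)).congr
    fun x => by simp [mul_comm]

end

/-! ## Integers and rational numbers -/

/-- The integers as differences of natural numbers. -/
def natDiff (p : ℕ × ℕ) : ℤ := p.1 - p.2

theorem intCode_eq_code (z : ℤ) : intCode z = code {p | natDiff p = z} := rfl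

theorem surjective_natDiff : natDiff.Surjective :=
  fun z => ⟨(z.toNat, (-z).toNat), by simp [natDiff]⟩

instance : Coded ℤ where
  code := intCode
  code_injective z w h := by
    obtain ⟨p, hp⟩ := surjective_natDiff z
    exact hp.symm.trans ((Set.ext_iff.1 (code_injective h) p).1 hp)

protected theorem RudFun.natDiff : RudFun natDiff := by
  have h : RudFun fun p : ℕ × ℕ => {q : ℕ × ℕ | q.1 + p.2 = p.1 + q.2} := by fun_prop
  refine h.code.of_code_eq fun p => (intCode_eq_code _).trans (congrArg code (Set.ext fun q => ?_))
  simp only [Set.mem_ofPred_eq, natDiff]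
  omega

instance : SetCoded ℤ := .of_surjective .natDiff surjective_natDiff

theorem ratCode_eq_code (q : ℚ) :
    ratCode q = code {p : ℤ × ℤ | p.2 ≠ 0 ∧ (p.1 : ℚ) / p.2 = q} := rfl

/-- The fractions with positive denominator, which is given by its predecessor. -/
def fraction (p : ℤ × ℕ) : ℚ := p.1 / (p.2 + 1)

theorem surjective_fraction : Function.Surjective fraction := fun q =>
  ⟨(q.num, q.den - 1), by
    rw [fraction, ← Nat.cast_add_one, Nat.sub_add_cancel q.den_pos, q.num_div_den]⟩

instance : Coded ℚ where
  code := ratCode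
  code_injective q r h := by
    have hq : (q.den : ℤ) ≠ 0 ∧ (q.num : ℚ) / (q.den : ℤ) = q :=
      ⟨mod_cast q.den_ne_zero, mod_cast q.num_div_den⟩
    exact hq.2.symm.trans
      ((Set.ext_iff.1 (code_injective (α := Set (ℤ × ℤ)) h) (q.num, q.den)).1 hq).2

section

variable {α : Type*} [Coded α]

@[fun_prop]
protected theorem RudFun.natCast_int {f : α → ℕ} (hf : RudFun f) : RudFun fun x => (f x : ℤ) :=
  (RudFun.natDiff.comp (hf.prodMk (.const 0))).congr fun x => by simp [natDiff]

@[fun_prop]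
protected theorem RudFun.intAdd {f g : α → ℤ} (hf : RudFun f) (hg : RudFun g) :
    RudFun fun x => f x + g x := by
  let sum (p : (ℕ × ℕ) × ℕ × ℕ) : ℤ := natDiff (p.1.1 + p.2.1, p.1.2 + p.2.2)
  have hsum : RudFun sum := RudFun.natDiff.comp (by fun_prop)
  refine .of_comp_surjective₂ .natDiff surjective_natDiff hsum (fun p q => ?_) hf hg
  simp only [sum, natDiff]
  push_cast
  ring

@[fun_prop]
protected theorem RudFun.intMul {f g : α → ℤ} (hf : RudFun f) (hg : RudFun g) :
    RudFun fun x => f x * g x := by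
  let prod (p : (ℕ × ℕ) × ℕ × ℕ) : ℤ :=
    natDiff (p.1.1 * p.2.1 + p.1.2 * p.2.2, p.1.1 * p.2.2 + p.1.2 * p.2.1)
  have hprod : RudFun prod := RudFun.natDiff.comp (by fun_prop)
  refine .of_comp_surjective₂ .natDiff surjective_natDiff hprod (fun p q => ?_) hf hg
  simp only [prod, natDiff]
  push_cast
  ring

end

protected theorem RudFun.fraction : RudFun fraction := by
  have h : RudFun fun p : ℤ × ℕ =>
      {q : ℤ × ℤ | ¬ q.2 = 0 ∧ q.1 * (p.2 + 1 : ℕ) = p.1 * q.2} := by fun_prop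
  refine h.code.of_code_eq fun p => (ratCode_eq_code _).trans (congrArg code (Set.ext fun q => ?_))
  refine and_congr_right fun hq => ?_
  rw [fraction, div_eq_div_iff (mod_cast hq) (by positivity)]
  norm_cast

instance : SetCoded ℚ := .of_surjective .fraction surjective_fraction

section

variable {α : Type*} [Coded α] {f g : α → ℚ}

@[fun_prop]
protected theorem RudFun.ratAdd (hf : RudFun f) (hg : RudFun g) : RudFun fun x => f x + g x := by
  let sum (p : (ℤ × ℕ) × ℤ × ℕ) : ℚ := fraction
    (p.1.1 * (p.2.2 + 1 : ℕ) + p.2.1 * (p.1.2 + 1 : ℕ), p.1.2 * p.2.2 + p.1.2 + p.2.2)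
  have hsum : RudFun sum := RudFun.fraction.comp (by fun_prop)
  refine .of_comp_surjective₂ .fraction surjective_fraction hsum (fun p q => ?_) hf hg
  simp only [sum, fraction]
  push_cast
  field_simp
  ring

@[fun_prop]
protected theorem RudFun.ratMul (hf : RudFun f) (hg : RudFun g) : RudFun fun x => f x * g x := by
  let prod (p : (ℤ × ℕ) × ℤ × ℕ) : ℚ := fraction
    (p.1.1 * p.2.1, p.1.2 * p.2.2 + p.1.2 + p.2.2)
  have hprod : RudFun prod := RudFun.fraction.comp (by fun_prop)
  refine .of_comp_surjective₂ .fraction surjective_fraction hprod (fun p q => ?_) hf hg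
  simp only [prod, fraction]
  push_cast
  field_simp
  ring

@[fun_prop]
protected theorem RudFun.ratNeg (hf : RudFun f) : RudFun fun x => -f x :=
  .of_graph <| (by fun_prop : RudFun fun p : α × ℚ => f p.1 + p.2 = 0).congr fun _ =>
    propext neg_eq_iff_add_eq_zero

@[fun_prop]
protected theorem RudFun.ratLE (hf : RudFun f) (hg : RudFun g) : RudFun fun x => f x ≤ g x := by
  let d (p : ℕ × ℕ) : ℚ := fraction ((p.1 : ℤ), p.2)
  have hd : RudFun d := RudFun.fraction.comp (by fun_prop)
  refine (by fun_prop : RudFun fun x => ∃ p, f x + d p = g x).congr fun x =>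
    propext ⟨fun h => ?_, ?_⟩
  · obtain ⟨⟨a, n⟩, h'⟩ := surjective_fraction (g x - f x)
    have hd : 0 ≤ (a : ℚ) / (n + 1) := h'.ge.trans' (sub_nonneg.2 h)
    have ha : (0 : ℚ) ≤ a := by simpa using (le_div_iff₀ (by positivity)).1 hd
    rw [Int.cast_nonneg_iff] at ha
    exact ⟨(a.toNat, n), by simp [d, Int.toNat_of_nonneg ha, h']⟩
  · rintro ⟨p, h⟩
    have hp : 0 ≤ d p := by
      simp only [d, fraction]
      positivity
    linarith

@[fun_prop]
protected theorem RudFun.ratLT (hf : RudFun f) (hg : RudFun g) : RudFun fun x => f x < g x :=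
  (by fun_prop : RudFun fun x => ¬ g x ≤ f x).congr fun x => by simp

end

/-! ## ι-classes and ι-functions given by rudimentary functions -/

theorem pair_mem_J2_iff {a b : ZFSet.{0}} : ZFSet.pair a b ∈ J2 ↔ a ∈ J2 ∧ b ∈ J2 := by
  refine ⟨fun h => ?_, fun h => isRudClosed_J2.pair_mem h.1 h.2⟩
  have hab : {a, b} ∈ J2 := mem_J2_of_mem (by simp [ZFSet.pair]) h
  exact ⟨mem_J2_of_mem (by simp) hab, mem_J2_of_mem (by simp) hab⟩

/-- A class of elements of `J₂` is rudimentary if it is the class of those satisfying a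
rudimentary relation with parameters from `J₂`. Such a class is an ι-class. -/
def IsRudClass (X : Set ZFSet.{0}) : Prop :=
  ∃ P : ZFSet.{0} → Prop, RudFun P ∧ ∀ x, x ∈ X ↔ x ∈ J2 ∧ P x

theorem fst_pair (a b : ZFSet.{0}) : fst (ZFSet.pair a b) = a := by
  have h : ∃ a' b', ZFSet.pair a b = ZFSet.pair a' b' := ⟨a, b, rfl⟩
  rw [fst, dif_pos h]
  exact (ZFSet.pair_inj.1 h.choose_spec.choose_spec).1.symm

theorem snd_pair (a b : ZFSet.{0}) : snd (ZFSet.pair a b) = b := by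
  have h : ∃ b' a', ZFSet.pair a b = ZFSet.pair a' b' := ⟨b, a, rfl⟩
  rw [snd, dif_pos h]
  exact (ZFSet.pair_inj.1 h.choose_spec.choose_spec).2.symm

namespace IsRudClass

variable {X Y Z : Set ZFSet.{0}}

protected theorem isIotaClass (hX : IsRudClass X) : IsIotaClass X := by
  obtain ⟨P, hP, h⟩ := hX
  rw [Set.ext h]
  exact hP.isIotaClass

theorem of_pairs {R : ZFSet.{0} → ZFSet.{0} → Prop}
    (hR : RudFun fun p : ZFSet.{0} × ZFSet.{0} => R p.1 p.2)
    (hX : ∀ z, z ∈ X ↔ ∃ a ∈ J2, ∃ b ∈ J2, R a b ∧ z = ZFSet.pair a b) : IsRudClass X := by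
  refine ⟨fun z => ∃ a ∈ ZFSet.sUnion z, ∃ b ∈ ZFSet.sUnion z, R a b ∧ z = ZFSet.pair a b,
    by fun_prop, fun z => (hX z).trans ⟨?_, ?_⟩⟩
  · rintro ⟨a, ha, b, hb, h, rfl⟩
    exact ⟨pair_mem_J2_iff.2 ⟨ha, hb⟩, a, by simp [sUnion_kuratowski_pair], b,
      by simp [sUnion_kuratowski_pair], h, rfl⟩
  · rintro ⟨hz, a, -, b, -, h, rfl⟩
    exact ⟨a, (pair_mem_J2_iff.1 hz).1, b, (pair_mem_J2_iff.1 hz).2, h, rfl⟩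

protected theorem classProd (hX : IsRudClass X) (hY : IsRudClass Y) :
    IsRudClass (classProd X Y) := by
  obtain ⟨P, hP, h⟩ := hX
  obtain ⟨Q, hQ, h'⟩ := hY
  refine of_pairs (R := fun a b => P a ∧ Q b) (by fun_prop) fun z => ?_
  simp only [IotaAnalysis.classProd, Set.mem_ofPred_eq, h, h']
  grind

protected theorem graph (hX : IsRudClass X) {G : ZFSet.{0} → ZFSet.{0}} (hG : RudFun G) :
    IsRudClass (graph X G) := by
  obtain ⟨P, hP, h⟩ := hX
  refine of_pairs (R := fun a b => P a ∧ b = G a) (by fun_prop) fun z => ?_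
  simp only [IotaAnalysis.graph, Set.mem_ofPred_eq, h]
  constructor
  · rintro ⟨a, ⟨ha, hPa⟩, rfl⟩
    exact ⟨a, ha, G a, hG.code_mem_J2 (x := a) ha, ⟨hPa, rfl⟩, rfl⟩
  · rintro ⟨a, ha, _, -, ⟨hPa, rfl⟩, rfl⟩
    exact ⟨a, ⟨ha, hPa⟩, rfl⟩

protected theorem isIotaFunction (hX : IsRudClass X) (hY : IsRudClass Y)
    {F G : ZFSet.{0} → ZFSet.{0}} (hG : RudFun G) (hFG : Set.EqOn F G X) (hF : Set.MapsTo F X Y) :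
    IsIotaFunction X Y F where
  domain := hX.isIotaClass
  codomain := hY.isIotaClass
  mapsTo := hF
  graph_class := by
    convert! (hX.graph hG).isIotaClass using 1
    ext z
    exact exists_congr fun a => and_congr_right fun ha => by rw [hFG ha]
  image_bound x hx := by
    have hr : RudFun fun x : ZFSet.{0} => replacement x G := by fun_prop
    exact ⟨_, hr.code_mem_J2 (x := x) hx.1, fun a ha => mem_replacement.2 ⟨a, ha, hFG (hx.2 ha)⟩⟩

theorem isIotaFunction_classProd (hX : IsRudClass X) (hY : IsRudClass Y) (hZ : IsRudClass Z)
    {op : ZFSet.{0} → ZFSet.{0} → ZFSet.{0}}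
    (hop : RudFun fun p : ZFSet.{0} × ZFSet.{0} => op p.1 p.2)
    (h : ∀ a ∈ X, ∀ b ∈ Y, op a b ∈ Z) :
    IsIotaFunction (classProd X Y) Z fun p => op (fst p) (snd p) := by
  obtain ⟨G, hG, hGop⟩ := hop.exists_extend
  refine (hX.classProd hY).isIotaFunction hZ (G := G) hG ?_ ?_
  · rintro _ ⟨a, -, b, -, rfl⟩
    simpa [fst_pair, snd_pair] using (hGop (a, b)).symm
  · rintro _ ⟨a, ha, b, hb, rfl⟩
    simpa only [fst_pair, snd_pair] using h a ha b hb

end IsRudClass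

/-! ## Dedekind cuts -/

theorem mem_ofRats {A : Set ℚ} {x : ZFSet.{0}} : x ∈ ofRats A ↔ ∃ q ∈ A, code q = x :=
  mem_code_set

theorem code_mem_ofRats {A : Set ℚ} {q : ℚ} : code q ∈ ofRats A ↔ q ∈ A := code_mem_code_set

theorem ratSet_eq_codes : ratSet = codes ℚ := by
  ext z
  rw [ratSet, ZFSet.mem_range, mem_codes]
  rfl

@[simp]
theorem toRats_ofRats (A : Set ℚ) : toRats (ofRats A) = A := Set.ext fun _ => code_mem_ofRats

theorem ofRats_toRats {x : ZFSet.{0}} (hx : x ⊆ ratSet) : ofRats (toRats x) = x := by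
  ext z
  rw [mem_ofRats]
  refine ⟨fun ⟨_, hq, h⟩ => h ▸ hq, fun hz => ?_⟩
  obtain ⟨q, rfl⟩ := mem_codes.1 (ratSet_eq_codes ▸ hx hz)
  exact ⟨q, hz, rfl⟩

theorem ofRats_subset_ratSet (A : Set ℚ) : ofRats A ⊆ ratSet := by
  intro z hz
  obtain ⟨q, -, rfl⟩ := mem_ofRats.1 hz
  exact ratSet_eq_codes ▸ mem_codes.2 ⟨q, rfl⟩

theorem ofRats_subset_ofRats {A B : Set ℚ} : ofRats A ⊆ ofRats B ↔ A ⊆ B := by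
  refine ⟨fun h q hq => code_mem_ofRats.1 (h (code_mem_ofRats.2 hq)), fun h z hz => ?_⟩
  obtain ⟨q, hq, rfl⟩ := mem_ofRats.1 hz
  exact code_mem_ofRats.2 (h hq)

section

variable {α : Type*} [Coded α] {f g : α → Set ℚ} {u v : α → ZFSet.{0}}

@[fun_prop]
protected theorem RudFun.toRats (hu : RudFun u) : RudFun fun x => toRats (u x) :=
  (by fun_prop : RudFun fun x => {q : ℚ | code q ∈ u x})

@[fun_prop]
protected theorem RudFun.ofRats (hf : RudFun f) : RudFun fun x => ofRats (f x) := hf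

@[fun_prop]
protected theorem RudFun.isCut (hf : RudFun f) : RudFun fun x => IsCut (f x) :=
  (by fun_prop : RudFun fun x => (∃ q, q ∈ f x) ∧ (∃ q, ¬ q ∈ f x) ∧
    (¬ ∃ a, a ∈ f x ∧ ∀ b, b ∈ f x → b ≤ a) ∧ ∀ a, a ∈ f x → ∀ b, b < a → b ∈ f x).congr
      fun x => by
    rw [IsCut, ← Set.nonempty_iff_ne_empty, Set.ne_univ_iff_exists_notMem]
    rfl

@[fun_prop]
protected theorem RudFun.cutAdd (hf : RudFun f) (hg : RudFun g) :
    RudFun fun x => cutAdd (f x) (g x) :=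
  (by fun_prop : RudFun fun x => {q | ∃ a, a ∈ f x ∧ ∃ b, b ∈ g x ∧ q = a + b})

@[fun_prop]
protected theorem RudFun.cutNeg (hf : RudFun f) : RudFun fun x => cutNeg (f x) :=
  (by fun_prop : RudFun fun x => {q | ∃ r, ¬ r ∈ f x ∧ q < -r})

@[fun_prop]
protected theorem RudFun.cutMulNonneg (hf : RudFun f) (hg : RudFun g) :
    RudFun fun x => cutMulNonneg (f x) (g x) :=
  (by fun_prop : RudFun fun x =>
    {q | q < 0 ∨ ∃ a, a ∈ f x ∧ ∃ b, b ∈ g x ∧ 0 ≤ a ∧ 0 ≤ b ∧ q = a * b})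

@[fun_prop]
protected theorem RudFun.cutZero_subset (hf : RudFun f) : RudFun fun x => cutZero ⊆ f x :=
  (by fun_prop : RudFun fun x => ∀ q : ℚ, q < 0 → q ∈ f x)

@[fun_prop]
protected theorem RudFun.cutMul (hf : RudFun f) (hg : RudFun g) :
    RudFun fun x => cutMul (f x) (g x) := by
  unfold IotaAnalysis.cutMul
  fun_prop

@[fun_prop]
protected theorem RudFun.add (hu : RudFun u) (hv : RudFun v) : RudFun fun x => add (u x) (v x) := by
  unfold IotaAnalysis.add
  fun_prop

@[fun_prop]
protected theorem RudFun.mul (hu : RudFun u) (hv : RudFun v) : RudFun fun x => mul (u x) (v x) := by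
  unfold IotaAnalysis.mul
  fun_prop

end

theorem isRudClass_RIota : IsRudClass RIota :=
  ⟨fun x => x ⊆ codes ℚ ∧ IsCut (toRats x), by fun_prop, fun x => by
    rw [← ratSet_eq_codes, ← and_assoc]
    rfl⟩

/-- The lower cut of a real number. -/
def lowerCut (r : ℝ) : Set ℚ := {q | (q : ℝ) < r}

@[simp]
theorem mem_lowerCut {r : ℝ} {q : ℚ} : q ∈ lowerCut r ↔ (q : ℝ) < r := Iff.rfl

theorem lowerCut_subset_lowerCut {r s : ℝ} : lowerCut r ⊆ lowerCut s ↔ r ≤ s :=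
  ⟨fun h => le_of_forall_rat_lt_imp_le fun _ hq => (h hq).le, fun h _ hq => hq.trans_le h⟩

theorem lowerCut_injective : Function.Injective lowerCut := fun _ _ h =>
  le_antisymm (lowerCut_subset_lowerCut.1 h.subset) (lowerCut_subset_lowerCut.1 h.superset)

theorem isCut_lowerCut (r : ℝ) : IsCut (lowerCut r) := by
  refine ⟨Set.nonempty_iff_ne_empty.1 (exists_rat_lt r), ?_, ?_, fun a ha b hb => ?_⟩
  · obtain ⟨q, hq⟩ := exists_rat_gt r
    exact (Set.ne_univ_iff_exists_notMem _).2 ⟨q, fun h => lt_asymm hq h⟩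
  · rintro ⟨a, ha, h⟩
    obtain ⟨q, hq, hq'⟩ := exists_rat_btwn (mem_lowerCut.1 ha)
    exact (h hq').not_gt (Rat.cast_lt.1 hq)
  · exact (Rat.cast_lt.2 hb).trans (mem_lowerCut.1 ha)

theorem IsCut.exists_eq_lowerCut {A : Set ℚ} (hA : IsCut A) : ∃ r, A = lowerCut r := by
  obtain ⟨hne, hproper, hmax, hlower⟩ := hA
  rw [← Set.nonempty_iff_ne_empty] at hne
  obtain ⟨p, hp⟩ := (Set.ne_univ_iff_exists_notMem _).1 hproper
  have hbdd : BddAbove ((↑) '' A : Set ℝ) := ⟨p, Set.forall_mem_image.2 fun q hq =>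
    Rat.cast_le.2 <| not_lt.1 fun h => hp (hlower q hq p h)⟩
  have hA q : q ∈ A ↔ ∃ q' ∈ A, q < q' := by
    refine ⟨fun hq => ?_, fun ⟨q', hq', h⟩ => hlower q' hq' q h⟩
    by_contra! h
    exact hmax ⟨q, hq, h⟩
  refine ⟨sSup ((↑) '' A), Set.ext fun q => (hA q).trans ?_⟩
  simp [lt_csSup_iff hbdd (hne.image _)]

theorem cutZero_subset_lowerCut {r : ℝ} : cutZero ⊆ lowerCut r ↔ 0 ≤ r := by
  have h : cutZero = lowerCut 0 := by
    ext
    simp [cutZero]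
  rw [h, lowerCut_subset_lowerCut]

theorem cutAdd_lowerCut (r s : ℝ) : cutAdd (lowerCut r) (lowerCut s) = lowerCut (r + s) := by
  ext q
  constructor
  · rintro ⟨a, ha, b, hb, rfl⟩
    simpa using add_lt_add (mem_lowerCut.1 ha) (mem_lowerCut.1 hb)
  · intro hq
    obtain ⟨a, ha, ha'⟩ := exists_rat_btwn (sub_lt_iff_lt_add.2 (mem_lowerCut.1 hq))
    exact ⟨a, ha', q - a, by simpa using sub_lt_comm.1 ha, by ring⟩

theorem cutNeg_lowerCut (r : ℝ) : cutNeg (lowerCut r) = lowerCut (-r) := by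
  ext q
  constructor
  · rintro ⟨p, hp, hq⟩
    have hp : r ≤ p := not_lt.1 hp
    have hq : (q : ℝ) < -p := mod_cast hq
    exact hq.trans_le (neg_le_neg hp)
  · intro hq
    obtain ⟨p, hp, hp'⟩ := exists_rat_btwn (lt_neg.1 (mem_lowerCut.1 hq))
    exact ⟨p, fun h => lt_asymm hp h, lt_neg.1 (mod_cast hp')⟩

theorem cutMulNonneg_lowerCut {r s : ℝ} (hr : 0 ≤ r) (hs : 0 ≤ s) :
    cutMulNonneg (lowerCut r) (lowerCut s) = lowerCut (r * s) := by
  ext q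
  constructor
  · rintro (hq | ⟨a, ha, b, hb, ha0, hb0, rfl⟩)
    · exact (Rat.cast_lt_zero.2 hq).trans_le (mul_nonneg hr hs)
    · rw [mem_lowerCut, Rat.cast_mul]
      exact mul_lt_mul'' ha hb (Rat.cast_nonneg.2 ha0) (Rat.cast_nonneg.2 hb0)
  · intro hq
    rcases lt_or_ge q 0 with hq0 | hq0
    · exact .inl hq0
    · have hq0' : (0 : ℝ) ≤ q := Rat.cast_nonneg.2 hq0
      have hs : 0 < s := pos_of_mul_pos_right (hq0'.trans_lt hq) hr
      obtain ⟨a, ha, ha'⟩ := exists_rat_btwn ((div_lt_iff₀ hs).2 hq)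
      have ha0' : (0 : ℝ) < a := (div_nonneg hq0' hs.le).trans_lt ha
      have ha0 : 0 < a := Rat.cast_pos.1 ha0'
      refine .inr ⟨a, ha', q / a, ?_, ha0.le, div_nonneg hq0 ha0.le, by field_simp⟩
      rw [mem_lowerCut, Rat.cast_div]
      exact (div_lt_comm₀ hs ha0').1 ha

theorem cutMul_lowerCut (r s : ℝ) : cutMul (lowerCut r) (lowerCut s) = lowerCut (r * s) := by
  simp only [cutMul, cutZero_subset_lowerCut, cutNeg_lowerCut]
  split_ifs with hr hs hs
  · exact cutMulNonneg_lowerCut hr hs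
  · rw [cutMulNonneg_lowerCut hr (by linarith), cutNeg_lowerCut, mul_neg, neg_neg]
  · rw [cutMulNonneg_lowerCut (by linarith) hs, cutNeg_lowerCut, neg_mul, neg_neg]
  · rw [cutMulNonneg_lowerCut (by linarith) (by linarith), neg_mul_neg]

/-- The reciprocal of a positive cut. -/
def cutInv (A : Set ℚ) : Set ℚ := {q | ∃ p, p ∉ A ∧ p * q < 1}

theorem cutInv_lowerCut {r : ℝ} (hr : 0 < r) : cutInv (lowerCut r) = lowerCut r⁻¹ := by
  ext q
  constructor
  · rintro ⟨p, hp, hpq⟩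
    have hp : r ≤ p := not_lt.1 hp
    have hpq : (p : ℝ) * q < 1 := mod_cast hpq
    rw [mem_lowerCut, inv_eq_one_div, lt_div_iff₀ hr]
    rcases le_or_gt (q : ℝ) 0 with h | h <;> nlinarith
  · intro hq
    obtain ⟨p, hp, hpq⟩ : ∃ p : ℚ, r < p ∧ (p : ℝ) * q < 1 := by
      rcases le_or_gt (q : ℝ) 0 with h | h
      · obtain ⟨p, hp⟩ := exists_rat_gt r
        exact ⟨p, hp, by nlinarith⟩
      · obtain ⟨p, hp, hp'⟩ := exists_rat_btwn ((lt_inv_comm₀ h hr).1 hq)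
        rw [inv_eq_one_div, lt_div_iff₀ h] at hp'
        exact ⟨p, hp, hp'⟩
    exact ⟨p, fun h => lt_asymm hp h, mod_cast hpq⟩

/-! ## The field of ι-real numbers -/

/-- A real number as a set, namely the set of (codes of) the rational numbers below it. -/
def realCode (r : ℝ) : ZFSet.{0} := ofRats (lowerCut r)

theorem realCode_injective : Function.Injective realCode := fun _ _ h =>
  lowerCut_injective (code_injective (α := Set ℚ) h)

theorem realCode_subset_realCode {r s : ℝ} : realCode r ⊆ realCode s ↔ r ≤ s :=
  ofRats_subset_ofRats.trans lowerCut_subset_lowerCut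

theorem mem_RIota {x : ZFSet.{0}} : x ∈ RIota ↔ x ∈ J2 ∧ ∃ r, realCode r = x := by
  constructor
  · rintro ⟨⟨hx, hx'⟩, hcut⟩
    obtain ⟨r, hr⟩ := hcut.exists_eq_lowerCut
    exact ⟨hx, r, by rw [realCode, ← hr, ofRats_toRats hx']⟩
  · rintro ⟨hx, r, rfl⟩
    refine ⟨⟨hx, ofRats_subset_ratSet _⟩, ?_⟩
    rw [realCode, toRats_ofRats]
    exact isCut_lowerCut r

theorem add_realCode (r s : ℝ) : add (realCode r) (realCode s) = realCode (r + s) := by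
  simp only [add, realCode, toRats_ofRats, cutAdd_lowerCut]

theorem mul_realCode (r s : ℝ) : mul (realCode r) (realCode s) = realCode (r * s) := by
  simp only [mul, realCode, toRats_ofRats, cutMul_lowerCut]

theorem realCode_ratCast_mem_J2 (q : ℚ) : realCode q ∈ J2 := by
  have h : RudFun fun q : ℚ => {p | p < q} := by fun_prop
  have hq : lowerCut q = {p | p < q} := by
    ext p
    simp
  rw [realCode, hq]
  exact h.code_mem_J2 (mem_J2_of_mem (mem_codes.2 ⟨q, rfl⟩) codes_mem_J2)

theorem realCode_neg_mem_J2 {r : ℝ} (hr : realCode r ∈ J2) : realCode (-r) ∈ J2 := by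
  have h : RudFun fun A : Set ℚ => cutNeg A := by fun_prop
  rw [realCode, ← cutNeg_lowerCut]
  exact h.code_mem_J2 hr

theorem realCode_inv_mem_J2_of_pos {r : ℝ} (h0 : 0 < r) (hr : realCode r ∈ J2) :
    realCode r⁻¹ ∈ J2 := by
  have h : RudFun cutInv := (by fun_prop : RudFun fun A : Set ℚ => {q | ∃ p, ¬ p ∈ A ∧ p * q < 1})
  rw [realCode, ← cutInv_lowerCut h0]
  exact h.code_mem_J2 hr

/-- The real numbers whose cuts are ι-sets. -/
def iotaReals : Subfield ℝ where
  carrier := {r | realCode r ∈ J2}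
  mul_mem' {r s} hr hs := by
    have h : RudFun fun p : ZFSet.{0} × ZFSet.{0} => mul p.1 p.2 := by fun_prop
    simpa [mul_realCode] using
      h.code_mem_J2 (x := (realCode r, realCode s)) (pair_mem_J2_iff.2 ⟨hr, hs⟩)
  one_mem' := by simpa using realCode_ratCast_mem_J2 1
  add_mem' {r s} hr hs := by
    have h : RudFun fun p : ZFSet.{0} × ZFSet.{0} => add p.1 p.2 := by fun_prop
    simpa [add_realCode] using
      h.code_mem_J2 (x := (realCode r, realCode s)) (pair_mem_J2_iff.2 ⟨hr, hs⟩)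
  zero_mem' := by simpa using realCode_ratCast_mem_J2 0
  neg_mem' hr := realCode_neg_mem_J2 hr
  inv_mem' r hr := by
    rcases lt_trichotomy r 0 with h | rfl | h
    · simpa [inv_neg] using realCode_neg_mem_J2 <|
        realCode_inv_mem_J2_of_pos (neg_pos.2 h) (realCode_neg_mem_J2 hr)
    · rwa [inv_zero]
    · exact realCode_inv_mem_J2_of_pos h hr

/-- The ι-real line is the field of real numbers whose cuts are ι-sets. -/
def equivRIota : RIota ≃ iotaReals :=
  (Equiv.ofBijective (fun r : iotaReals => (⟨realCode r, mem_RIota.2 ⟨r.2, r, rfl⟩⟩ : RIota))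
    ⟨fun r s h => Subtype.ext (realCode_injective (congrArg Subtype.val h)), fun ⟨x, hx⟩ => by
      obtain ⟨hx', r, rfl⟩ := mem_RIota.1 hx
      exact ⟨⟨r, hx'⟩, rfl⟩⟩).symm

instance : Field RIota := equivRIota.field

/-- The embedding of the ι-real line into the real line. -/
def toReal : RIota →+* ℝ := iotaReals.subtype.comp equivRIota.ringEquiv.toRingHom

@[simp]
theorem realCode_toReal (a : RIota) : realCode (toReal a) = a :=
  congrArg Subtype.val (equivRIota.symm_apply_apply a)

theorem toReal_le_toReal {a b : RIota} : toReal a ≤ toReal b ↔ a ≤ b := by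
  rw [← realCode_subset_realCode, realCode_toReal, realCode_toReal]
  rfl

theorem coe_add_RIota (a b : RIota) : ((a + b : RIota) : ZFSet.{0}) = add a b := by
  rw [← realCode_toReal (a + b), map_add, ← add_realCode, realCode_toReal, realCode_toReal]

theorem coe_mul_RIota (a b : RIota) : ((a * b : RIota) : ZFSet.{0}) = mul a b := by
  rw [← realCode_toReal (a * b), map_mul, ← mul_realCode, realCode_toReal, realCode_toReal]

theorem isIotaFunction_add :
    IsIotaFunction (classProd RIota RIota) RIota (fun p => add (fst p) (snd p)) :=
  isRudClass_RIota.isIotaFunction_classProd isRudClass_RIota isRudClass_RIota (by fun_prop)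
    fun a ha b hb => coe_add_RIota ⟨a, ha⟩ ⟨b, hb⟩ ▸ Subtype.prop _

theorem isIotaFunction_mul :
    IsIotaFunction (classProd RIota RIota) RIota (fun p => mul (fst p) (snd p)) :=
  isRudClass_RIota.isIotaFunction_classProd isRudClass_RIota isRudClass_RIota (by fun_prop)
    fun a ha b hb => coe_mul_RIota ⟨a, ha⟩ ⟨b, hb⟩ ▸ Subtype.prop _

theorem isIotaRelation_leRel : IsIotaRelation RIota leRel := by
  refine ⟨isRudClass_RIota.isIotaClass, ?_, ?_⟩
  · obtain ⟨P, hP, h⟩ := isRudClass_RIota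
    refine (IsRudClass.of_pairs (R := fun a b => P a ∧ P b ∧ a ⊆ b) (by fun_prop)
      fun z => ?_).isIotaClass
    constructor
    · rintro ⟨a, b, hab, rfl⟩
      exact ⟨a, ((h a).1 a.2).1, b, ((h b).1 b.2).1, ⟨((h a).1 a.2).2, ((h b).1 b.2).2, hab⟩, rfl⟩
    · rintro ⟨a, ha, b, hb, ⟨hPa, hPb, hab⟩, rfl⟩
      exact ⟨⟨a, (h a).2 ⟨ha, hPa⟩⟩, ⟨b, (h b).2 ⟨hb, hPb⟩⟩, hab, rfl⟩
  · rintro _ ⟨a, b, -, rfl⟩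
    exact ⟨a, a.2, b, b.2, rfl⟩

/-! ## Least upper bounds -/

theorem code_mem_coe_RIota {a : RIota} {q : ℚ} :
    code q ∈ (a : ZFSet.{0}) ↔ (q : ℝ) < toReal a := by
  rw [← realCode_toReal a, realCode, code_mem_ofRats, mem_lowerCut]

theorem mem_coe_RIota {a : RIota} {z : ZFSet.{0}} :
    z ∈ (a : ZFSet.{0}) ↔ ∃ q : ℚ, (q : ℝ) < toReal a ∧ code q = z := by
  rw [← realCode_toReal a, realCode, mem_ofRats]
  simp

theorem mem_boundedSubsets {x : ZFSet.{0}} : x ∈ boundedSubsets ↔ x ∈ J2 ∧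
    (∀ y ∈ x, y ∈ RIota) ∧ (∃ y, y ∈ x) ∧ ∃ q : ℚ, code q ∉ ZFSet.sUnion x := by
  constructor
  · rintro ⟨⟨hx, hsub⟩, ⟨a, ha⟩, ⟨b, hb⟩⟩
    obtain ⟨q, hq⟩ := exists_rat_gt (toReal b)
    refine ⟨hx, hsub, ⟨a, ha⟩, q, fun h => ?_⟩
    obtain ⟨y, hy, hqy⟩ := ZFSet.mem_sUnion.1 h
    have hyb : code q ∈ (b : ZFSet.{0}) := (hb hy : (⟨y, hsub hy⟩ : RIota) ≤ b) hqy
    exact lt_asymm hq (code_mem_coe_RIota.1 hyb)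
  · rintro ⟨hx, hsub, ⟨y, hy⟩, q, hq⟩
    refine ⟨⟨hx, hsub⟩, ⟨⟨y, hsub y hy⟩, hy⟩,
      ⟨realCode q, mem_RIota.2 ⟨realCode_ratCast_mem_J2 q, q, rfl⟩⟩, fun a ha => ?_⟩
    change (a : ZFSet.{0}) ⊆ realCode q
    rw [← realCode_toReal a, realCode_subset_realCode]
    by_contra! h
    exact hq (ZFSet.mem_sUnion.2 ⟨a, ha, code_mem_coe_RIota.2 h⟩)

theorem sUnion_eq_realCode_sSup {x : ZFSet.{0}} (hx : x ∈ boundedSubsets) :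
    ZFSet.sUnion x = realCode (sSup (toReal '' realsIn x)) := by
  obtain ⟨⟨-, hsub⟩, hne, ⟨b, hb⟩⟩ := hx
  have hbdd : BddAbove (toReal '' realsIn x) :=
    ⟨toReal b, Set.forall_mem_image.2 fun a ha => toReal_le_toReal.2 (hb ha)⟩
  ext z
  simp only [ZFSet.mem_sUnion, realCode, mem_ofRats, mem_lowerCut,
    lt_csSup_iff hbdd (hne.image _), Set.exists_mem_image]
  constructor
  · rintro ⟨y, hy, hz⟩
    obtain ⟨q, hq, rfl⟩ := mem_coe_RIota (a := ⟨y, hsub hy⟩).1 hz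
    exact ⟨q, ⟨_, hy, hq⟩, rfl⟩
  · rintro ⟨q, ⟨a, ha, hq⟩, rfl⟩
    exact ⟨a, ha, code_mem_coe_RIota.2 hq⟩

theorem isLUB_sUnion {x : ZFSet.{0}} (hx : x ∈ boundedSubsets) :
    ∃ s : RIota, ZFSet.sUnion x = s ∧ IsLUB (realsIn x) s := by
  have hU : RudFun fun x : ZFSet.{0} => ZFSet.sUnion x := by fun_prop
  have hmem : ZFSet.sUnion x ∈ RIota :=
    mem_RIota.2 ⟨hU.code_mem_J2 (x := x) hx.1.1, _, (sUnion_eq_realCode_sSup hx).symm⟩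
  refine ⟨⟨_, hmem⟩, rfl, fun a ha z hz => ZFSet.mem_sUnion.2 ⟨a, ha, hz⟩, fun c hc z hz => ?_⟩
  obtain ⟨y, hy, hz⟩ := ZFSet.mem_sUnion.1 hz
  exact (hc hy : (⟨y, hx.1.2 hy⟩ : RIota) ≤ c) hz

theorem isRudClass_boundedSubsets : IsRudClass boundedSubsets := by
  obtain ⟨P, hP, h⟩ := isRudClass_RIota
  refine ⟨fun x => (¬ ∃ y ∈ x, ¬ P y) ∧ (∃ y ∈ x, True) ∧ ∃ q : ℚ, ¬ code q ∈ ZFSet.sUnion x,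
    by fun_prop, fun x => ?_⟩
  rw [mem_boundedSubsets]
  simp only [and_true]
  push Not
  refine and_congr_right fun hx => and_congr_left fun _ => forall₂_congr fun y hy => ?_
  rw [h]
  exact and_iff_right (mem_J2_of_mem hy hx)

theorem isIotaFunction_sUnion : IsIotaFunction boundedSubsets RIota ZFSet.sUnion :=
  isRudClass_boundedSubsets.isIotaFunction isRudClass_RIota (G := ZFSet.sUnion) (by fun_prop)
    (fun _ _ => rfl) fun x hx => by
      obtain ⟨s, hs, -⟩ := isLUB_sUnion hx
      exact hs ▸ s.2

/-! ## Finite subsets of `J₁` -/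

theorem RudTerm.hereditarily_finite_eval {n : ℕ} (t : RudTerm n) {v : Fin n → ZFSet.{0}}
    (hv : ∀ i, (v i).Hereditarily fun z => (z : Set ZFSet.{0}).Finite) :
    (t.eval v).Hereditarily fun z => (z : Set ZFSet.{0}).Finite := by
  induction t with
  | proj i => exact hv i
  | upair i j =>
    refine ZFSet.hereditarily_iff.2 ⟨?_, fun y hy => ?_⟩
    · simp [eval]
    · rcases ZFSet.mem_pair.1 hy with rfl | rfl <;> exact hv _
  | diff i j =>
    have hsub : (RudTerm.diff i j).eval v ⊆ v i := fun y hy => (ZFSet.mem_sdiff.1 hy).1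
    exact ZFSet.hereditarily_iff.2 ⟨(hv i).self.subset hsub, fun y hy => (hv i).mem (hsub hy)⟩
  | comp _ _ ihG ihH => exact ihG fun i => ihH i hv
  | union H ih =>
    have hH {w : ZFSet.{0}} (hw : w ∈ v 0) := ih (v := Fin.cons w fun i => v i.succ) <|
      Fin.cases ((hv 0).mem hw) fun i => hv i.succ
    refine ZFSet.hereditarily_iff.2 ⟨?_, fun y hy => ?_⟩
    · refine ((hv 0).self.biUnion fun w hw => (hH hw).self).subset fun y hy => ?_
      obtain ⟨⟨w, hw⟩, h⟩ := ZFSet.mem_iUnion.1 hy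
      exact Set.mem_biUnion hw h
    · obtain ⟨⟨w, hw⟩, h⟩ := ZFSet.mem_iUnion.1 hy
      exact (hH hw).mem h

theorem finite_of_mem_J1 {x : ZFSet.{0}} (hx : x ∈ J1) : (x : Set ZFSet.{0}).Finite := by
  obtain ⟨n, t, v, hv, rfl⟩ := mem_rudClosure.1 hx
  refine (t.hereditarily_finite_eval fun i => ?_).self
  rcases ZFSet.mem_insert_iff.1 (hv i) with h | h
  · exact h ▸ ZFSet.hereditarily_iff.2 ⟨by simp, by simp⟩
  · exact (ZFSet.notMem_empty _ h).elim

section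

variable {α γ : Type*} [Coded α] [Coded γ]

theorem finite_iff_exists_mem_J1 {A : Set J1} :
    A.Finite ↔ ∃ c : J1, A = {s | code s ∈ code c} := by
  constructor
  · intro hA
    induction A, hA using Set.Finite.induction_on with
    | empty => exact ⟨⟨∅, empty_mem_J1⟩, Set.ext fun s =>
        iff_of_false (Set.notMem_empty s) (ZFSet.notMem_empty _)⟩
    | @insert a A _ _ ih =>
      obtain ⟨c, rfl⟩ := ih
      refine ⟨⟨_, isRudClosed_J1.insert_mem a.2 c.2⟩, Set.ext fun s => ?_⟩
      exact (Subtype.ext_iff.or Iff.rfl).trans ZFSet.mem_insert_iff.symm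
  · rintro ⟨c, rfl⟩
    exact (finite_of_mem_J1 c.2).preimage code_injective.injOn

@[fun_prop]
protected theorem RudFun.exists_finite [SetCoded γ] [Nonempty γ] [Small.{0} γ]
    {P : α → Set γ → Prop} (hP : RudFun fun p : α × Set γ => P p.1 p.2) :
    RudFun fun x => ∃ A : Set γ, A.Finite ∧ P x A := by
  obtain ⟨π, hπ, hsurj⟩ := exists_surjective_rudFun γ
  have himage : RudFun fun p : α × J1 => (p.1, {a | ∃ s : J1, code s ∈ code p.2 ∧ π s = a}) := by
    fun_prop
  have hP' := RudFun.exists (P := fun x (c : J1) => P x (π '' {s | code s ∈ code c}))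
    (hP.comp himage)
  refine hP'.congr fun x => propext ⟨fun ⟨A, hA, h⟩ => ?_, fun ⟨c, h⟩ =>
    ⟨_, (finite_iff_exists_mem_J1.2 ⟨c, rfl⟩).image π, h⟩⟩
  obtain ⟨c, hc⟩ := finite_iff_exists_mem_J1.1 (hA.image (Function.surjInv hsurj))
  have hA' : π '' {s | code s ∈ code c} = A := by
    simp [← hc, Set.image_image, Function.surjInv_eq]
  exact ⟨c, hA'.symm ▸ h⟩

end

/-! ## Finite derivations -/

section

variable {γ : Type*} {R : Set γ → γ → Prop}

/-- A rule system, where `R A a` says that `a` is a direct consequence of the statements in `A`, is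
finitary if every direct consequence of `A` is one of a finite subset of `A`. -/
def IsFinitary (R : Set γ → γ → Prop) : Prop :=
  ∀ A a, R A a ↔ ∃ B ⊆ A, B.Finite ∧ R B a

/-- A set of statements is a derivation if each of them is a direct consequence of the set. This
allows circular arguments, but it is an elementary condition on the set. -/
def IsDerivation (R : Set γ → γ → Prop) (A : Set γ) : Prop := ∀ a ∈ A, R A a

/-- A statement is derivable if it belongs to a finite derivation. -/
def Derivable (R : Set γ → γ → Prop) (a : γ) : Prop := ∃ A, A.Finite ∧ IsDerivation R A ∧ a ∈ A

namespace IsFinitary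

theorem monotone (hR : IsFinitary R) (a : γ) : Monotone fun A => R A a := fun A A' hA h =>
  let ⟨B, hB, hB', h'⟩ := (hR A a).1 h
  (hR A' a).2 ⟨B, hB.trans hA, hB', h'⟩

theorem isDerivation_biUnion (hR : IsFinitary R) {ι : Type*} {s : Set ι} {A : ι → Set γ}
    (hA : ∀ i ∈ s, IsDerivation R (A i)) : IsDerivation R (⋃ i ∈ s, A i) := fun a ha =>
  let ⟨_, hi, ha⟩ := Set.mem_iUnion₂.1 ha
  hR.monotone a (Set.subset_biUnion_of_mem hi) (hA _ hi a ha)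

theorem isDerivation_insert (hR : IsFinitary R) {A : Set γ} {a : γ} (hA : IsDerivation R A)
    (ha : R A a) : IsDerivation R (insert a A) := by
  rintro b (rfl | hb)
  exacts [hR.monotone _ (Set.subset_insert _ _) ha,
    hR.monotone _ (Set.subset_insert _ _) (hA b hb)]

theorem derivable_iff (hR : IsFinitary R) {a : γ} :
    Derivable R a ↔ R {b | Derivable R b} a := by
  refine ⟨fun ⟨A, hA, hA', ha⟩ => hR.monotone a (fun b hb => ⟨A, hA, hA', hb⟩) (hA' a ha),
    fun h => ?_⟩
  obtain ⟨B, hB, hfin, h⟩ := (hR _ a).1 h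
  have hder : ∀ b ∈ B, Derivable R b := fun _ hb => hB hb
  choose! A hA hA' hmem using hder
  have hBA : B ⊆ ⋃ b ∈ B, A b := fun b hb => Set.mem_biUnion hb (hmem b hb)
  exact ⟨_, (hfin.biUnion hA).insert a,
    hR.isDerivation_insert (hR.isDerivation_biUnion hA') (hR.monotone a hBA h),
    Set.mem_insert _ _⟩

end IsFinitary

protected theorem RudFun.derivable [Coded γ] [SetCoded γ] [Nonempty γ] [Small.{0} γ]
    (hR : RudFun fun p : Set γ × γ => R p.1 p.2) : RudFun (Derivable R) := by
  unfold Derivable IsDerivation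
  fun_prop

end

/-! ## Generated subfields -/

section

variable {F : Type*} [Field F]

theorem half_mem_of_inv_mem {W : AddSubgroup F} (hinv : ∀ a ∈ W, a⁻¹ ∈ W) {a : F} (ha : a ∈ W) :
    a / 2 ∈ W := by
  convert! hinv _ (W.add_mem (hinv a ha) (hinv a ha)) using 1
  rw [← two_mul, mul_inv, inv_inv, mul_comm, ← div_eq_mul_inv]

theorem mul_self_mem_of_inv_mem {W : AddSubgroup F} (h1 : 1 ∈ W) (hinv : ∀ a ∈ W, a⁻¹ ∈ W) {a : F}
    (ha : a ∈ W) : a * a ∈ W := by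
  by_cases h : a = 0
  · simp [h]
  by_cases h' : a + 1 = 0
  · simpa [eq_neg_of_add_eq_zero_left h'] using h1
  have hua : (a⁻¹ - (a + 1)⁻¹)⁻¹ - a = a * a := by
    have : a⁻¹ - (a + 1)⁻¹ = (a * (a + 1))⁻¹ := by field_simp; ring
    rw [this, inv_inv]
    ring
  exact hua ▸ W.sub_mem (hinv _ (W.sub_mem (hinv a ha) (hinv _ (W.add_mem ha h1)))) ha

theorem mul_mem_of_inv_mem [NeZero (2 : F)] {W : AddSubgroup F} (h1 : 1 ∈ W)
    (hinv : ∀ a ∈ W, a⁻¹ ∈ W) {a b : F} (ha : a ∈ W) (hb : b ∈ W) : a * b ∈ W := by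
  have hsq {c : F} (hc : c ∈ W) : c * c ∈ W := mul_self_mem_of_inv_mem h1 hinv hc
  have hpolar : ((a + b) * (a + b) - a * a - b * b) / 2 = a * b := by
    have : (2 : F) ≠ 0 := NeZero.ne 2
    field_simp
    ring
  exact hpolar ▸ half_mem_of_inv_mem hinv
    (W.sub_mem (W.sub_mem (hsq (W.add_mem ha hb)) (hsq ha)) (hsq hb))

theorem closure_subset_of_inv_mem_of_pos [LinearOrder F] [IsStrictOrderedRing F]
    {W : AddSubgroup F} (h1 : 1 ∈ W) (hinv : ∀ a ∈ W, 0 < a → a⁻¹ ∈ W) {G : Set F} (hG : G ⊆ W) :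
    (Subfield.closure G : Set F) ⊆ W := by
  have hinv' a (ha : a ∈ W) : a⁻¹ ∈ W := by
    rcases lt_trichotomy a 0 with h | rfl | h
    · simpa [inv_neg] using hinv _ (W.neg_mem ha) (neg_pos.2 h)
    · simp
    · exact hinv a ha h
  let S : Subfield F :=
    { W with
      mul_mem' := mul_mem_of_inv_mem h1 hinv'
      one_mem' := h1
      inv_mem' := hinv' }
  exact (Subfield.closure_le (t := S)).2 hG

end

section

/-- The code of the field term for the generator with index `s`. -/
def genTerm (s : J1) : J1 := inJ1 ((0 : ℕ), s)

/-- The code of the difference of two field terms. -/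
def subTerm (s t : J1) : J1 := inJ1 ((1 : ℕ), inJ1 (s, t))

/-- The code of the reciprocal of a field term. -/
def invTerm (s : J1) : J1 := inJ1 ((2 : ℕ), s)

theorem rank_lt_inJ1_left {γ : Type*} [Coded γ] [J1Coded γ] (s : J1) (c : γ) :
    (code s).rank < (code (inJ1 (s, c))).rank := by
  simp [ZFSet.pair]

theorem rank_lt_inJ1_right {γ : Type*} [Coded γ] [J1Coded γ] (c : γ) (s : J1) :
    (code s).rank < (code (inJ1 (c, s))).rank := by
  simp [ZFSet.pair]

variable (C : J1 → Set ℚ)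

/-- The rules of interval arithmetic: `EnclosureRule C A t p q` says that bounds `p` and `q` for the
value of the term `t` follow from the bounds for its immediate subterms in `A`, where `C s` is the
lower cut of the value of the generator with index `s`. -/
def EnclosureRule (A : Set (J1 × ℚ × ℚ)) (t : J1) (p q : ℚ) : Prop :=
  (∃ s, t = genTerm s ∧ p ∈ C s ∧ q ∉ C s) ∨
  (∃ s₁ s₂ p₁ q₁ p₂ q₂, t = subTerm s₁ s₂ ∧ (s₁, p₁, q₁) ∈ A ∧ (s₂, p₂, q₂) ∈ A ∧ p + q₂ ≤ p₁ ∧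
    q₁ ≤ q + p₂) ∨
  ∃ s p₁ q₁, t = invTerm s ∧ (s, p₁, q₁) ∈ A ∧ 0 < p₁ ∧ p * q₁ ≤ 1 ∧ 1 ≤ q * p₁

/-- The bounds `p` and `q` for the value of the term `t` are derivable by interval arithmetic. -/
def Encloses (t : J1) (p q : ℚ) : Prop :=
  Derivable (fun A b => EnclosureRule C A b.1 b.2.1 b.2.2) (t, p, q)

variable {C}

theorem isFinitary_enclosureRule :
    IsFinitary fun A (b : J1 × ℚ × ℚ) => EnclosureRule C A b.1 b.2.1 b.2.2 := by
  refine fun A b => ⟨?_, fun ⟨B, hBA, _, h⟩ => ?_⟩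
  · rintro (h | ⟨s₁, s₂, p₁, q₁, p₂, q₂, ht, h₁, h₂, h⟩ | ⟨s, p₁, q₁, ht, h₁, h⟩)
    · exact ⟨∅, Set.empty_subset A, Set.finite_empty, .inl h⟩
    · exact ⟨{(s₁, p₁, q₁), (s₂, p₂, q₂)}, Set.pair_subset h₁ h₂, Set.toFinite _,
        .inr (.inl ⟨s₁, s₂, p₁, q₁, p₂, q₂, ht, by simp, by simp, h⟩)⟩
    · exact ⟨{(s, p₁, q₁)}, Set.singleton_subset_iff.2 h₁, Set.finite_singleton _,
        .inr (.inr ⟨s, p₁, q₁, ht, by simp, h⟩)⟩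
  · rcases h with h | ⟨s₁, s₂, p₁, q₁, p₂, q₂, ht, h₁, h₂, h⟩ | ⟨s, p₁, q₁, ht, h₁, h⟩
    · exact .inl h
    · exact .inr (.inl ⟨s₁, s₂, p₁, q₁, p₂, q₂, ht, hBA h₁, hBA h₂, h⟩)
    · exact .inr (.inr ⟨s, p₁, q₁, ht, hBA h₁, h⟩)

theorem encloses_iff {t : J1} {p q : ℚ} :
    Encloses C t p q ↔ EnclosureRule C {b | Encloses C b.1 b.2.1 b.2.2} t p q :=
  isFinitary_enclosureRule.derivable_iff

theorem encloses_genTerm {s : J1} {p q : ℚ} :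
    Encloses C (genTerm s) p q ↔ p ∈ C s ∧ q ∉ C s := by
  rw [encloses_iff]
  simp [EnclosureRule, genTerm, subTerm, invTerm, -Subtype.exists]

theorem encloses_subTerm {s t : J1} {p q : ℚ} : Encloses C (subTerm s t) p q ↔
    ∃ p₁ q₁ p₂ q₂, Encloses C s p₁ q₁ ∧ Encloses C t p₂ q₂ ∧ p + q₂ ≤ p₁ ∧ q₁ ≤ q + p₂ := by
  rw [encloses_iff]
  simp [EnclosureRule, genTerm, subTerm, invTerm, -Subtype.exists]

theorem encloses_invTerm {s : J1} {p q : ℚ} : Encloses C (invTerm s) p q ↔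
    ∃ p₁ q₁, Encloses C s p₁ q₁ ∧ 0 < p₁ ∧ p * q₁ ≤ 1 ∧ 1 ≤ q * p₁ := by
  rw [encloses_iff]
  simp [EnclosureRule, genTerm, subTerm, invTerm, -Subtype.exists]

theorem Encloses.exists_term {t : J1} {p q : ℚ} (h : Encloses C t p q) :
    (∃ s, t = genTerm s) ∨ (∃ s₁ s₂, t = subTerm s₁ s₂) ∨ ∃ s, t = invTerm s := by
  rcases encloses_iff.1 h with ⟨s, hs, -⟩ | ⟨s₁, s₂, _, _, _, _, hs, -⟩ | ⟨s, _, _, hs, -⟩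
  exacts [.inl ⟨s, hs⟩, .inr (.inl ⟨s₁, s₂, hs⟩), .inr (.inr ⟨s, hs⟩)]

theorem RudFun.encloses (hC : RudFun C) :
    RudFun fun p : J1 × ℚ × ℚ => Encloses C p.1 p.2.1 p.2.2 := by
  refine RudFun.derivable ?_
  unfold EnclosureRule genTerm subTerm invTerm
  fun_prop

variable (C) in
/-- The term `t` has the value `a` if `a` satisfies all derivable bounds for `t`, and every
nondegenerate interval around `a` is derivable. -/
def HasValue (t : J1) (a : ℝ) : Prop :=
  (∀ p q, Encloses C t p q → p ≤ a ∧ a ≤ q) ∧ ∀ p q : ℚ, p < a → a < q → Encloses C t p q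

theorem hasValue_genTerm {s : J1} {a : ℝ} (h : C s = lowerCut a) : HasValue C (genTerm s) a := by
  simp only [HasValue, encloses_genTerm, h, mem_lowerCut, not_lt]
  exact ⟨fun p q h => ⟨h.1.le, h.2⟩, fun p q hp hq => ⟨hp, hq.le⟩⟩

theorem HasValue.subTerm {s t : J1} {a b : ℝ} (hs : HasValue C s a) (ht : HasValue C t b) :
    HasValue C (subTerm s t) (a - b) := by
  refine ⟨fun p q h => ?_, fun p q hp hq => encloses_subTerm.2 ?_⟩
  · obtain ⟨p₁, q₁, p₂, q₂, h₁, h₂, hp, hq⟩ := encloses_subTerm.1 h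
    have hp' : (p + q₂ : ℝ) ≤ p₁ := mod_cast hp
    have hq' : (q₁ : ℝ) ≤ q + p₂ := mod_cast hq
    have := hs.1 _ _ h₁
    have := ht.1 _ _ h₂
    constructor <;> linarith
  · obtain ⟨p₁, hp₁, hp₁'⟩ := exists_rat_btwn (show p + b < a by linarith)
    obtain ⟨q₁, hq₁, hq₁'⟩ := exists_rat_btwn (show a < q + b by linarith)
    refine ⟨p₁, q₁, q₁ - q, p₁ - p, hs.2 _ _ hp₁' hq₁, ht.2 _ _ ?_ ?_, by simp, by simp⟩ <;>
      push_cast <;> linarith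

theorem inv_mem_Icc {a p q p₁ q₁ : ℝ} (hp₁ : 0 < p₁) (ha : a ∈ Set.Icc p₁ q₁) (hp : p * q₁ ≤ 1)
    (hq : 1 ≤ q * p₁) : a⁻¹ ∈ Set.Icc p q := by
  have ha0 := hp₁.trans_le ha.1
  constructor
  · calc p ≤ q₁⁻¹ := by rwa [inv_eq_one_div, le_div_iff₀ (ha0.trans_le ha.2)]
      _ ≤ a⁻¹ := inv_anti₀ ha0 ha.2
  · calc a⁻¹ ≤ p₁⁻¹ := inv_anti₀ hp₁ ha.1
      _ ≤ q := by rwa [inv_eq_one_div, div_le_iff₀ hp₁]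

theorem exists_rat_mul_le_one {a : ℝ} (ha : 0 < a) {p : ℚ} (hp : p < a⁻¹) :
    ∃ q : ℚ, a < q ∧ p * q ≤ 1 := by
  rcases le_or_gt p 0 with h | h
  · obtain ⟨q, hq⟩ := exists_rat_gt a
    have hq0 : 0 < q := mod_cast ha.trans hq
    exact ⟨q, hq, by nlinarith⟩
  · have hp0 : (0 : ℝ) < p := mod_cast h
    obtain ⟨q, hq, hq'⟩ := exists_rat_btwn ((lt_inv_comm₀ hp0 ha).1 hp)
    rw [inv_eq_one_div, lt_div_iff₀ hp0] at hq'
    exact ⟨q, hq, by exact_mod_cast (mul_comm (p : ℝ) q ▸ hq').le⟩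

theorem exists_rat_one_le_mul {a : ℝ} (ha : 0 < a) {q : ℚ} (hq : a⁻¹ < q) :
    ∃ p : ℚ, 0 < p ∧ p < a ∧ 1 ≤ q * p := by
  have hq0 : (0 : ℝ) < q := (inv_pos.2 ha).trans hq
  obtain ⟨p, hp, hp'⟩ := exists_rat_btwn ((inv_lt_comm₀ ha hq0).1 hq)
  have hp0 : (0 : ℝ) < p := (inv_pos.2 hq0).trans hp
  rw [inv_eq_one_div, div_lt_iff₀ hq0] at hp
  exact ⟨p, mod_cast hp0, hp', by exact_mod_cast (mul_comm (p : ℝ) q ▸ hp).le⟩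

theorem HasValue.invTerm {s : J1} {a : ℝ} (hs : HasValue C s a) (ha : 0 < a) :
    HasValue C (invTerm s) a⁻¹ := by
  refine ⟨fun p q h => ?_, fun p q hp hq => encloses_invTerm.2 ?_⟩
  · obtain ⟨p₁, q₁, h₁, h0, hp, hq⟩ := encloses_invTerm.1 h
    exact inv_mem_Icc (mod_cast h0) (hs.1 _ _ h₁) (mod_cast hp) (mod_cast hq)
  · obtain ⟨q₁, hq₁, hpq⟩ := exists_rat_mul_le_one ha hp
    obtain ⟨p₁, hp₀, hp₁, hqp⟩ := exists_rat_one_le_mul ha hq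
    exact ⟨p₁, q₁, hs.2 _ _ hp₁ hq₁, hp₀, hpq, hqp⟩

theorem Encloses.exists_hasValue {K : Subfield ℝ} (hC : ∀ s, ∃ a ∈ K, C s = lowerCut a) {t : J1}
    {p q : ℚ} (h : Encloses C t p q) : ∃ a ∈ K, HasValue C t a := by
  induction t using WellFounded.induction
    (InvImage.wf (fun t : J1 => (code t).rank) Ordinal.lt_wf) generalizing p q with | _ t ih =>
  rcases h.exists_term with ⟨s, rfl⟩ | ⟨s₁, s₂, rfl⟩ | ⟨s, rfl⟩
  · obtain ⟨a, ha, hs⟩ := hC s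
    exact ⟨a, ha, hasValue_genTerm hs⟩
  · obtain ⟨_, _, _, _, h₁, h₂, -⟩ := encloses_subTerm.1 h
    obtain ⟨a, ha, hs₁⟩ := ih s₁ ((rank_lt_inJ1_left _ _).trans (rank_lt_inJ1_right _ _)) h₁
    obtain ⟨b, hb, hs₂⟩ := ih s₂ ((rank_lt_inJ1_right _ _).trans (rank_lt_inJ1_right _ _)) h₂
    exact ⟨a - b, K.sub_mem ha hb, hs₁.subTerm hs₂⟩
  · obtain ⟨p₁, _, h₁, h0, -⟩ := encloses_invTerm.1 h
    obtain ⟨a, ha, hs⟩ := ih s (rank_lt_inJ1_right _ _) h₁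
    have hp₁ : (0 : ℝ) < p₁ := mod_cast h0
    exact ⟨a⁻¹, K.inv_mem ha, hs.invTerm (hp₁.trans_le (hs.1 _ _ h₁).1)⟩

variable (C) in
/-- The lower cut of the value of the term `t`; it is empty if `t` has no value. -/
def valueCut (t : J1) : Set ℚ := {r | ∃ p q, Encloses C t p q ∧ r < p}

theorem RudFun.valueCut (hC : RudFun C) : RudFun (valueCut C) := by
  have h := RudFun.encloses hC
  unfold IotaAnalysis.valueCut
  fun_prop

theorem HasValue.valueCut_eq {t : J1} {a : ℝ} (h : HasValue C t a) : valueCut C t = lowerCut a := by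
  ext r
  rw [mem_lowerCut]
  refine ⟨fun ⟨p, q, hpq, hr⟩ => ?_, fun hr => ?_⟩
  · have hr' : (r : ℝ) < p := mod_cast hr
    exact hr'.trans_le (h.1 _ _ hpq).1
  · obtain ⟨p, hp, hp'⟩ := exists_rat_btwn hr
    obtain ⟨q, hq⟩ := exists_rat_gt a
    exact ⟨p, q, h.2 _ _ hp' hq, mod_cast hp⟩

theorem exists_hasValue_of_mem_closure {G : Set ℝ} (hG : ∀ a ∈ G, ∃ s, C s = lowerCut a)
    (h1 : 1 ∈ G) {a : ℝ} (ha : a ∈ Subfield.closure G) : ∃ t, HasValue C t a := by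
  have hval a (ha : a ∈ G) : ∃ t, HasValue C t a :=
    let ⟨_, hs⟩ := hG a ha
    ⟨_, hasValue_genTerm hs⟩
  refine closure_subset_of_inv_mem_of_pos
    (W := .ofSub {a | ∃ t, HasValue C t a} ⟨1, hval 1 h1⟩ ?_) (hval 1 h1) ?_ hval ha
  · rintro a ⟨s, hs⟩ b ⟨t, ht⟩
    exact ⟨_, hs.subTerm ht⟩
  · rintro a ⟨s, hs⟩ h0
    exact ⟨_, hs.invTerm h0⟩

theorem exists_valueCut_eq_iff {G : Set ℝ} (h1 : 1 ∈ G) (hC : Set.range C = lowerCut '' G) {a : ℝ} :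
    (∃ t, valueCut C t = lowerCut a) ↔ a ∈ Subfield.closure G := by
  constructor
  · rintro ⟨t, ht⟩
    obtain ⟨r, p, q, hpq, -⟩ : (valueCut C t).Nonempty :=
      Set.nonempty_iff_ne_empty.2 (ht ▸ (isCut_lowerCut a).1)
    obtain ⟨b, hb, htb⟩ := hpq.exists_hasValue (K := .closure G) fun s => by
      obtain ⟨b, hb, hs⟩ : C s ∈ lowerCut '' G := hC ▸ Set.mem_range_self s
      exact ⟨b, Subfield.subset_closure hb, hs.symm⟩
    rwa [← lowerCut_injective (htb.valueCut_eq.symm.trans ht)]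
  · intro ha
    have hG b (hb : b ∈ G) : lowerCut b ∈ Set.range C := hC ▸ Set.mem_image_of_mem lowerCut hb
    obtain ⟨t, ht⟩ := exists_hasValue_of_mem_closure hG h1 ha
    exact ⟨t, ht.valueCut_eq⟩

end

theorem toRats_coe_RIota (a : RIota) : toRats a = lowerCut (toReal a) := by
  rw [← realCode_toReal, realCode, toRats_ofRats]

theorem exists_rudFun_range_eq_lowerCut {x : ZFSet.{0}} (hx : IsIotaSubset x RIota)
    (hne : (realsIn x).Nonempty) :
    ∃ C : J1 → Set ℚ, RudFun C ∧ Set.range C = lowerCut '' (toReal '' realsIn x) := by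
  obtain ⟨a, ha⟩ := hne
  obtain ⟨h, hh, hrange⟩ := exists_rudFun_range_eq hx.1 ⟨a, ha⟩
  have hval : Subtype.val '' realsIn x = (x : Set ZFSet.{0}) := by
    ext y
    exact ⟨fun ⟨_, hb, hby⟩ => hby ▸ hb, fun hy => ⟨⟨y, hx.2 hy⟩, hy, rfl⟩⟩
  refine ⟨fun s => toRats (h s), by fun_prop, ?_⟩
  rw [Set.range_comp', hrange, ← hval, Set.image_image, Set.image_image]
  simp only [toRats_coe_RIota]

theorem exists_iotaSet_closure_of_one_mem {x : ZFSet.{0}} (hx : IsIotaSubset x RIota)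
    (h1 : 1 ∈ realsIn x) : ∃ s : ZFSet.{0}, IsIotaSet s ∧
      (s : Set ZFSet.{0}) = Subtype.val '' (Subfield.closure (realsIn x) : Set RIota) := by
  obtain ⟨C, hC, hrange⟩ := exists_rudFun_range_eq_lowerCut hx ⟨1, h1⟩
  obtain ⟨r, hr, hmem⟩ := (RudFun.valueCut hC).exists_range
  have hclosure (a : RIota) : (a : ZFSet.{0}) ∈ r ↔ a ∈ Subfield.closure (realsIn x) := by
    have hcode (c : J1) : code (valueCut C c) = (a : ZFSet.{0}) ↔
        valueCut C c = lowerCut (toReal a) := by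
      rw [← realCode_toReal]
      exact code_injective.eq_iff
    have h1' : 1 ∈ toReal '' realsIn x := ⟨1, h1, map_one _⟩
    simp only [hmem, hcode]
    rw [exists_valueCut_eq_iff h1' hrange, ← RingHom.map_field_closure]
    exact toReal.injective.mem_set_image
  refine ⟨_, isRudClass_RIota.isIotaClass.2 r hr, ?_⟩
  ext z
  simp only [SetLike.mem_coe, ZFSet.mem_sep, Set.mem_image]
  exact ⟨fun ⟨hzr, hz⟩ => ⟨⟨z, hz⟩, (hclosure ⟨z, hz⟩).1 hzr, rfl⟩,
    fun ⟨a, ha, haz⟩ => haz ▸ ⟨(hclosure a).2 ha, a.2⟩⟩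

theorem exists_iotaSet_closure {x : ZFSet.{0}} (hx : IsIotaSubset x RIota) :
    ∃ s : ZFSet.{0}, IsIotaSet s ∧
      (s : Set ZFSet.{0}) = Subtype.val '' (Subfield.closure (realsIn x) : Set RIota) := by
  let y : ZFSet.{0} := insert ((1 : RIota) : ZFSet.{0}) x
  have hreals : realsIn y = insert 1 (realsIn x) := by
    ext a
    simp [realsIn, y, Subtype.ext_iff]
  have hy : IsIotaSubset y RIota := by
    refine ⟨isRudClosed_J2.insert_mem (mem_RIota.1 (1 : RIota).2).1 hx.1, fun z hz => ?_⟩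
    rcases ZFSet.mem_insert_iff.1 hz with rfl | hz
    exacts [(1 : RIota).2, hx.2 hz]
  obtain ⟨s, hs, h⟩ := exists_iotaSet_closure_of_one_mem hy (hreals ▸ Set.mem_insert _ _)
  refine ⟨s, hs, ?_⟩
  rw [h, hreals, le_antisymm (Subfield.closure_le.2 (Set.insert_subset (one_mem _)
    Subfield.subset_closure)) (Subfield.closure_mono (Set.subset_insert _ _))]

end IotaAnalysis

end

open IotaAnalysis in
theorem theorem3p2 :
    -- the ι-real line is an ι-class
    IsIotaClass RIota ∧
    -- addition and multiplication are ι-functions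
    IsIotaFunction (classProd RIota RIota) RIota (fun p => add (fst p) (snd p)) ∧
    IsIotaFunction (classProd RIota RIota) RIota (fun p => mul (fst p) (snd p)) ∧
    -- the order is an ι-relation
    IsIotaRelation RIota leRel ∧
    -- these operations make the ι-real line a field, in which the subfield generated by any
    -- ι-subset is an ι-set
    (∃ _ : Field RIota,
      (∀ a b : RIota, ((a + b : RIota) : ZFSet.{0}) = add a b) ∧
      (∀ a b : RIota, ((a * b : RIota) : ZFSet.{0}) = mul a b) ∧
      ∀ x : ZFSet.{0}, IsIotaSubset x RIota →
        ∃ s : ZFSet.{0}, IsIotaSet s ∧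
          (s : Set ZFSet.{0}) = Subtype.val '' (Subfield.closure (realsIn x) : Set RIota)) ∧
    -- every nonempty ι-subset that is bounded above has a least upper bound
    (∀ x ∈ boundedSubsets, ∃ s : RIota, IsLUB (realsIn x) s) ∧
    -- the map taking each such subset to its least upper bound is an ι-function
    (∃ F : ZFSet.{0} → ZFSet.{0},
      (∀ x ∈ boundedSubsets, ∃ s : RIota, F x = s ∧ IsLUB (realsIn x) s) ∧
      IsIotaFunction boundedSubsets RIota F) :=
  ⟨isRudClass_RIota.isIotaClass, isIotaFunction_add, isIotaFunction_mul, isIotaRelation_leRel,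
    ⟨inferInstance, coe_add_RIota, coe_mul_RIota, fun _ hx => exists_iotaSet_closure hx⟩,
    fun _ hx => (isLUB_sUnion hx).imp fun _ h => h.2,
    ZFSet.sUnion, fun _ hx => isLUB_sUnion hx, isIotaFunction_sUnion⟩
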